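/- Let $G=PSL(3,\mathbb{R})=GL(3,\mathbb{R})/\mathbb{R}^\times$. For a real $3\times3$ matrix $X$ and a smooth $f:G\to\mathbb{C}$ put $(Xf)(g)=\frac{d}{dt}f(g\exp(tX))\big|_{t=0}$, let $E_{i,j}$ be the elementary matrices, and let \[ \Delta_1=-\tfrac12\sum_{i,j}E_{i,j}\circ E_{j,i},\qquad \Delta_2=\tfrac13\sum_{i,j,k}E_{i,j}\circ E_{j,k}\circ E_{k,i}+\Delta_1 . \] Use the Iwasawa coordinates $x_1,x_2,x_3\in\mathbb{R}$, $y_1,y_2>0$, $\alpha,\beta,\gamma\in\mathbb{R}$ with $\sin\beta\neq0$, for \[ g=\begin{pmatrix}1&x_2&x_3\\&1&x_1\\&&1\end{pmatrix}\begin{pmatrix}y_1y_2&&\\&y_1&\\&&1\end{pmatrix}k(\alpha,\beta,\gamma),\qquad k(\alpha,\beta,\gamma)=k(\alpha,0,0)\,w_3\,k(-\beta,0,0)\,w_3\,k(\gamma,0,0), \] \[ k(\theta,0,0)=\begin{pmatrix}\cos\theta&-\sin\theta&0\\ \sin\theta&\cos\theta&0\\0&0&1\end{pmatrix},\qquad w_3=-\begin{pmatrix}1&&\\&&1\\&1&\end{pmatrix}.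 \] In these coordinates define \begin{align*} K^{\mathrm{Left}}_0&=-\sqrt2\,\partial_\alpha,\qquad K^{\mathrm{Left}}_{\pm1}=e^{\pm i\alpha}\left(i\csc\beta\,\partial_\gamma-i\cot\beta\,\partial_\alpha\mp\partial_\beta\right),\\ Z_{\pm2}&=(2y_2\partial_{y_2}-y_1\partial_{y_1})\pm2iy_2\partial_{x_2},\quad Z_{\pm1}=-2iy_1(\partial_{x_1}+x_2\partial_{x_3})\mp2y_1y_2\partial_{x_3},\quad Z_0=-\sqrt6\,y_1\partial_{y_1},\\ \Delta_1^\circ&=-y_1^2\partial_{y_1}^2-y_2^2\partial_{y_2}^2+y_1y_2\partial_{y_1}\partial_{y_2}-y_1^2(x_2^2+y_2^2)\partial_{x_3}^2-y_1^2\partial_{x_1}^2-y_2^2\partial_{x_2}^2-2y_1^2x_2\partial_{x_1}\partial_{x_3},\\ \Delta_2^\circ&=-y_1^2y_2\partial_{y_1}^2\partial_{y_2}+y_1y_2^2\partial_{y_1}\partial_{y_2}^2-y_1^3y_2^2\partial_{x_3}^2\partial_{y_1}+y_1y_2^2\partial_{x_2}^2\partial_{y_1}-2y_1^2y_2x_2\partial_{x_1}\partial_{x_3}\partial_{y_2}\\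 &\quad+(-x_2^2+y_2^2)y_1^2y_2\partial_{x_3}^2\partial_{y_2}-y_1^2y_2\partial_{x_1}^2\partial_{y_2}+2y_1^2y_2^2\partial_{x_1}\partial_{x_2}\partial_{x_3}+2y_1^2y_2^2x_2\partial_{x_2}\partial_{x_3}^2\\ &\quad+y_1^2\partial_{y_1}^2-y_2^2\partial_{y_2}^2+2y_1^2x_2\partial_{x_1}\partial_{x_3}+(x_2^2+y_2^2)y_1^2\partial_{x_3}^2+y_1^2\partial_{x_1}^2-y_2^2\partial_{x_2}^2,\\ \mathcal T_{\pm1}&=\sqrt6\,Z_{\mp1}\circ Z_0+6(1-Z_{\mp2})\circ Z_{\pm1},\\ \mathcal T_0&=3(Z_1\circ Z_1-Z_{-1}\circ Z_{-1})+2(\sqrt6\,Z_0+6)\circ(Z_{-2}-Z_2). \end{align*} Then, acting on smooth functions on $G$ written in the Iwasawa coordinates, \begin{align*} 8\Delta_1&=8\Delta_1^\circ-2K^{\mathrm{Left}}_1\circ Z_{-1}-\sqrt2\,i\,K^{\mathrm{Left}}_0\circ(Z_2-Z_{-2})-2K^{\mathrm{Left}}_{-1}\circ Z_1,\\ 96\Delta_2&=96\Delta_2^\circ+2K^{\mathrm{Left}}_1\circ\mathcal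 T_1+\sqrt2\,i\,K^{\mathrm{Left}}_0\circ\mathcal T_0+2K^{\mathrm{Left}}_{-1}\circ\mathcal T_{-1}\\ &\quad+6\sqrt2\,i\,(K^{\mathrm{Left}}_1+K^{\mathrm{Left}}_{-1})\circ K^{\mathrm{Left}}_0\circ(Z_{-1}-Z_1). \end{align*} -/

import Mathlib

namespace CasimirPGL3

open scoped ContDiff

noncomputable section

/-- The group `G = PSL(3,ℝ) = GL(3,ℝ)/ℝˣ`. -/
abbrev G : Type := Matrix.ProjGenLinGroup (Fin 3) ℝ

/-- The pullback of a function on `G` to `GL(3,ℝ)`, as a function of the matrix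
(extended by zero to singular matrices). -/
def pullback (f : G → ℂ) (A : Matrix (Fin 3) (Fin 3) ℝ) : ℂ :=
  if h : A.det ≠ 0 then
    f (Matrix.ProjGenLinGroup.mk (Matrix.GeneralLinearGroup.mkOfDetNeZero A h))
  else 0

/-- Smooth functions on `G`: the pullback is an infinitely differentiable function of the nine
matrix entries on the open set of invertible matrices. -/
def IsSmooth (f : G → ℂ) : Prop :=
  ContDiffOn ℝ ∞ (fun A : Fin 3 → Fin 3 → ℝ => pullback f (Matrix.of A))
    {A | (Matrix.of A).det ≠ 0}

/-- The image of `exp X` in `G`. -/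
def expG (X : Matrix (Fin 3) (Fin 3) ℝ) : G :=
  Matrix.ProjGenLinGroup.mk (Matrix.isUnit_exp X).unit

/-- The action of a real matrix `X` as a left-invariant differential operator:
`(X f)(g) = d/dt f(g exp(tX))` at `t = 0`. -/
def lieAct (X : Matrix (Fin 3) (Fin 3) ℝ) (f : G → ℂ) (g : G) : ℂ :=
  deriv (fun t : ℝ => f (g * expG (t • X))) 0

/-- The operator attached to the elementary matrix `E_{i,j}`. -/
def E (i j : Fin 3) : (G → ℂ) → (G → ℂ) := lieAct (Matrix.single i j 1)

/-- `Δ₁ = -1/2 ∑ E_{i,j} ∘ E_{j,i}`. -/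
def casimir1 (f : G → ℂ) (g : G) : ℂ :=
  -(1 / 2) * ∑ i : Fin 3, ∑ j : Fin 3, (E i j ∘ E j i) f g

/-- `Δ₂ = 1/3 ∑ E_{i,j} ∘ E_{j,k} ∘ E_{k,i} + Δ₁`. -/
def casimir2 (f : G → ℂ) (g : G) : ℂ :=
  (1 / 3) * ∑ i : Fin 3, ∑ j : Fin 3, ∑ k : Fin 3, (E i j ∘ E j k ∘ E k i) f g + casimir1 f g

/-! Iwasawa coordinates `(x₁, x₂, x₃, y₁, y₂, α, β, γ)`, as points of `Fin 8 → ℝ`. -/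

/-- The points (or parameter values) `(x₁, x₂, x₃, y₁, y₂, α, β, γ)`. -/
abbrev Coords : Type := Fin 8 → ℝ

abbrev ix1 : Fin 8 := 0
abbrev ix2 : Fin 8 := 1
abbrev ix3 : Fin 8 := 2
abbrev iy1 : Fin 8 := 3
abbrev iy2 : Fin 8 := 4
abbrev iα : Fin 8 := 5
abbrev iβ : Fin 8 := 6
abbrev iγ : Fin 8 := 7

/-- The unipotent matrix `x`. -/
def matX (x1 x2 x3 : ℝ) : Matrix (Fin 3) (Fin 3) ℝ :=
  !![1, x2, x3; 0, 1, x1; 0, 0, 1]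

/-- The diagonal matrix `y`. -/
def matY (y1 y2 : ℝ) : Matrix (Fin 3) (Fin 3) ℝ :=
  !![y1 * y2, 0, 0; 0, y1, 0; 0, 0, 1]

/-- The rotation `k(θ,0,0)`. -/
def rotZ (θ : ℝ) : Matrix (Fin 3) (Fin 3) ℝ :=
  !![Real.cos θ, -Real.sin θ, 0; Real.sin θ, Real.cos θ, 0; 0, 0, 1]

/-- The Weyl element `w₃`. -/
def w3 : Matrix (Fin 3) (Fin 3) ℝ :=
  !![-1, 0, 0; 0, 0, -1; 0, -1, 0]

/-- `k(α,β,γ) = k(α,0,0) w₃ k(-β,0,0) w₃ k(γ,0,0)`. -/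
def matK (α β γ : ℝ) : Matrix (Fin 3) (Fin 3) ℝ :=
  rotZ α * w3 * rotZ (-β) * w3 * rotZ γ

/-- The matrix `x y k(α,β,γ)` with given Iwasawa coordinates. -/
def iwasawa (p : Coords) : Matrix (Fin 3) (Fin 3) ℝ :=
  matX (p ix1) (p ix2) (p ix3) * matY (p iy1) (p iy2) * matK (p iα) (p iβ) (p iγ)

/-- A function on `G` as a function of the Iwasawa coordinates. -/
def inCoords (f : G → ℂ) (p : Coords) : ℂ := pullback f (iwasawa p)

/-- Operators on functions of the Iwasawa coordinates. Sums, differences and scalar multiples are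
pointwise, products are written as compositions `∘`. -/
abbrev Op : Type := (Coords → ℂ) → (Coords → ℂ)

/-- The partial derivative in the `i`-th coordinate. -/
def pd (i : Fin 8) : Op := fun F p => lineDeriv ℝ F p (Pi.single i 1)

/-- Left `K`-operator `K₀ = -√2 ∂_α`. -/
def KL0 : Op := fun F p => -(Real.sqrt 2 : ℂ) * pd iα F p

/-- Left `K`-operators
`K_{±1} = e^{±iα} (i csc β ∂_γ - i cot β ∂_α ∓ ∂_β)`, with `ε = ±1`. -/
def KL1 (ε : ℂ) : Op := fun F p =>
  Complex.exp (ε * Complex.I * (p iα : ℂ)) *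
    (Complex.I * ((1 / Real.sin (p iβ) : ℝ) : ℂ) * pd iγ F p
      - Complex.I * ((Real.cos (p iβ) / Real.sin (p iβ) : ℝ) : ℂ) * pd iα F p
      - ε * pd iβ F p)

/-- `Z_{±2} = (2 y₂ ∂_{y₂} - y₁ ∂_{y₁}) ± 2 i y₂ ∂_{x₂}`, with `ε = ±1`. -/
def Z2 (ε : ℂ) : Op := fun F p =>
  (2 * (p iy2 : ℂ) * pd iy2 F p - (p iy1 : ℂ) * pd iy1 F p)
    + ε * 2 * Complex.I * (p iy2 : ℂ) * pd ix2 F p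

/-- `Z_{±1} = -2 i y₁ (∂_{x₁} + x₂ ∂_{x₃}) ∓ 2 y₁ y₂ ∂_{x₃}`, with `ε = ±1`. -/
def Z1 (ε : ℂ) : Op := fun F p =>
  -2 * Complex.I * (p iy1 : ℂ) * (pd ix1 F p + (p ix2 : ℂ) * pd ix3 F p)
    - ε * 2 * (p iy1 : ℂ) * (p iy2 : ℂ) * pd ix3 F p

/-- `Z₀ = -√6 y₁ ∂_{y₁}`. -/
def Z0 : Op := fun F p => -(Real.sqrt 6 : ℂ) * (p iy1 : ℂ) * pd iy1 F p

/-- The spherical part of `Δ₁`. -/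
def sph1 : Op := fun F p =>
  let x2 : ℂ := (p ix2 : ℂ)
  let y1 : ℂ := (p iy1 : ℂ)
  let y2 : ℂ := (p iy2 : ℂ);
  -y1 ^ 2 * pd iy1 (pd iy1 F) p
    - y2 ^ 2 * pd iy2 (pd iy2 F) p
    + y1 * y2 * pd iy1 (pd iy2 F) p
    - y1 ^ 2 * (x2 ^ 2 + y2 ^ 2) * pd ix3 (pd ix3 F) p
    - y1 ^ 2 * pd ix1 (pd ix1 F) p
    - y2 ^ 2 * pd ix2 (pd ix2 F) p
    - 2 * y1 ^ 2 * x2 * pd ix1 (pd ix3 F) p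

/-- The spherical part of `Δ₂`. -/
def sph2 : Op := fun F p =>
  let x2 : ℂ := (p ix2 : ℂ)
  let y1 : ℂ := (p iy1 : ℂ)
  let y2 : ℂ := (p iy2 : ℂ);
  -y1 ^ 2 * y2 * pd iy1 (pd iy1 (pd iy2 F)) p
    + y1 * y2 ^ 2 * pd iy1 (pd iy2 (pd iy2 F)) p
    - y1 ^ 3 * y2 ^ 2 * pd ix3 (pd ix3 (pd iy1 F)) p
    + y1 * y2 ^ 2 * pd ix2 (pd ix2 (pd iy1 F)) p
    - 2 * y1 ^ 2 * y2 * x2 * pd ix1 (pd ix3 (pd iy2 F)) p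
    + (-x2 ^ 2 + y2 ^ 2) * y1 ^ 2 * y2 * pd ix3 (pd ix3 (pd iy2 F)) p
    - y1 ^ 2 * y2 * pd ix1 (pd ix1 (pd iy2 F)) p
    + 2 * y1 ^ 2 * y2 ^ 2 * pd ix1 (pd ix2 (pd ix3 F)) p
    + 2 * y1 ^ 2 * y2 ^ 2 * x2 * pd ix2 (pd ix3 (pd ix3 F)) p
    + y1 ^ 2 * pd iy1 (pd iy1 F) p
    - y2 ^ 2 * pd iy2 (pd iy2 F) p
    + 2 * y1 ^ 2 * x2 * pd ix1 (pd ix3 F) p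
    + (x2 ^ 2 + y2 ^ 2) * y1 ^ 2 * pd ix3 (pd ix3 F) p
    + y1 ^ 2 * pd ix1 (pd ix1 F) p
    - y2 ^ 2 * pd ix2 (pd ix2 F) p

/-- `T_{±1} = √6 Z_{∓1} ∘ Z₀ + 6 (1 - Z_{∓2}) ∘ Z_{±1}`, with `ε = ±1`. -/
def T1 (ε : ℂ) : Op :=
  (Real.sqrt 6 : ℂ) • (Z1 (-ε) ∘ Z0) + (6 : ℂ) • ((id - Z2 (-ε)) ∘ Z1 ε)

/-- `T₀ = 3 (Z₁ ∘ Z₁ - Z_{-1} ∘ Z_{-1}) + 2 (√6 Z₀ + 6) ∘ (Z_{-2} - Z₂)`. -/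
def T0 : Op :=
  (3 : ℂ) • (Z1 1 ∘ Z1 1 - Z1 (-1) ∘ Z1 (-1))
    + (2 : ℂ) • (((Real.sqrt 6 : ℂ) • Z0 + (6 : ℂ) • id) ∘ (Z2 (-1) - Z2 1))

end

end CasimirPGL3

namespace CasimirPGL3

open scoped ContDiff
open Matrix

noncomputable section

set_option linter.unusedSimpArgs false

/-! Write `g = b k` with `b` upper triangular and `k` orthogonal. Since `g exp(tX) = b exp(t k X kᵀ)
k`, the operator `E_{i,j}` is `∑ k_{a,i} k_{b,j} M_{a,b}`, where `M_{a,b}` inserts `exp(t E_{a,b})`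
between `b` and `k`. For `a < b` this is a left-invariant field of the Borel factor. For `a > b`,
`E_{a,b} = E_{b,a} + (E_{a,b} - E_{b,a})` adds an infinitesimal rotation acting on `k` from the
left. Scalars act trivially, so `M_{3,3} = -(M_{1,1} + M_{2,2})`.

As operators, these `E_{i,j}` are the entries of `Kᵀ P K`, where `K` multiplies by the entries of
`k` and `P = M + diag(0,1,2)`; the diagonal cancels the terms in which `M` differentiates `k`. As `K
Kᵀ = 1`, the Casimir sums are traces of `Kᵀ P² K` and `Kᵀ P³ K`. Commuting `K` through `P` costs
only integer structure constants, so `K` disappears (`conjSum_mul`, `conjSum_self`). What remains is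
a noncommutative polynomial in eight fields, which `IwasawaRelations` puts in normal order.

The operators of the statement are polynomials in the same fields, for instance `K_{±1} = i R₂ ∓
R₁`, so both formulas become comparisons of normal forms (`quadratic_identity`, `cubic_identity`).
The analytic input is the chain rule through the coordinate map (`chartFn_E`). -/

/-! ### The algebra of smooth functions on the chart and its derivations. -/

/-- The range of the Iwasawa coordinates. -/
def chart : Set Coords := {p | 0 < p iy1 ∧ 0 < p iy2 ∧ Real.sin (p iβ) ≠ 0}

lemma isOpen_chart : IsOpen chart := by
  have h1 : IsOpen {p : Coords | 0 < p iy1} := isOpen_lt continuous_const (continuous_apply _)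
  have h2 : IsOpen {p : Coords | 0 < p iy2} := isOpen_lt continuous_const (continuous_apply _)
  have h3 : IsOpen {p : Coords | Real.sin (p iβ) ≠ 0} :=
    isOpen_ne_fun (Real.continuous_sin.comp (continuous_apply _)) continuous_const
  exact h1.inter (h2.inter h3)

open scoped Classical in
/-- Extension by zero of a function on the chart. -/
def extend (φ : chart → ℂ) (p : Coords) : ℂ := if h : p ∈ chart then φ ⟨p, h⟩ else 0

lemma extend_apply (φ : chart → ℂ) (p : chart) : extend φ p = φ p := by
  simp [extend]

/-- The algebra of smooth functions on the chart. -/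
def SmoothFn : Subalgebra ℂ (chart → ℂ) where
  carrier := {φ | ContDiffOn ℝ ∞ (extend φ) chart}
  mul_mem' {φ ψ} hφ hψ := (ContDiffOn.mul hφ hψ).congr fun p hp => by simp [extend, hp]
  add_mem' {φ ψ} hφ hψ := (ContDiffOn.add hφ hψ).congr fun p hp => by simp [extend, hp]
  algebraMap_mem' c := (contDiffOn_const (c := c)).congr fun p hp => by simp [extend, hp]

/-- The restriction to the chart of a function that is smooth there. -/
def restrict (F : Coords → ℂ) (hF : ContDiffOn ℝ ∞ F chart) : SmoothFn :=
  ⟨fun p => F p, hF.congr fun p hp => by simp [extend, hp]⟩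

@[simp] lemma restrict_apply (F : Coords → ℂ) (hF : ContDiffOn ℝ ∞ F chart) (p : chart) :
    (restrict F hF).1 p = F p := rfl

/-- The chart is open, so derivatives there see only values on the chart. This makes extension by
zero harmless. -/
lemma pd_congr {F H : Coords → ℂ} (h : ∀ p ∈ chart, F p = H p) (i : Fin 8) {p : Coords}
    (hp : p ∈ chart) : pd i F p = pd i H p :=
  Filter.EventuallyEq.lineDeriv_eq
    (Filter.eventuallyEq_of_mem (isOpen_chart.mem_nhds hp) h)

lemma differentiableAt_of_smoothOn {F : Coords → ℂ} (hF : ContDiffOn ℝ ∞ F chart) {p : Coords}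
    (hp : p ∈ chart) : DifferentiableAt ℝ F p :=
  (hF.contDiffAt (isOpen_chart.mem_nhds hp)).differentiableAt (by simp)

lemma pd_eq_fderiv {F : Coords → ℂ} (hF : ContDiffOn ℝ ∞ F chart) (i : Fin 8) {p : Coords}
    (hp : p ∈ chart) : pd i F p = fderiv ℝ F p (Pi.single i 1) :=
  (differentiableAt_of_smoothOn hF hp).lineDeriv_eq_fderiv

lemma contDiffOn_pd {F : Coords → ℂ} (hF : ContDiffOn ℝ ∞ F chart) (i : Fin 8) :
    ContDiffOn ℝ ∞ (pd i F) chart :=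
  ((hF.fderiv_of_isOpen isOpen_chart (by simp)).clm_apply contDiffOn_const).congr
    fun _ hp => pd_eq_fderiv hF i hp

lemma pd_comm {F : Coords → ℂ} (hF : ContDiffOn ℝ ∞ F chart) (i j : Fin 8) {p : Coords}
    (hp : p ∈ chart) : pd i (pd j F) p = pd j (pd i F) p := by
  have key : ∀ i j : Fin 8, pd i (pd j F) p
      = fderiv ℝ (fderiv ℝ F) p (Pi.single i 1) (Pi.single j 1) := by
    intro i j
    rw [pd_congr (fun q hq => pd_eq_fderiv hF j hq) i hp]
    have hd : DifferentiableAt ℝ (fderiv ℝ F) p :=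
      ((hF.fderiv_of_isOpen (m := ∞) isOpen_chart (by simp)).contDiffAt
        (isOpen_chart.mem_nhds hp)).differentiableAt (by simp)
    have hd' : HasFDerivAt (fun q => fderiv ℝ F q (Pi.single j 1)) _ p :=
      hd.hasFDerivAt.clm_apply (hasFDerivAt_const (Pi.single j (1 : ℝ) : Coords) p)
    rw [pd, hd'.differentiableAt.lineDeriv_eq_fderiv, hd'.fderiv]
    simp
  rw [key, key]
  exact ((hF.contDiffAt (isOpen_chart.mem_nhds hp)).isSymmSndFDerivAt
    (by simpa using WithTop.coe_le_coe.2 (le_top : (2 : ℕ∞) ≤ ⊤))).eq _ _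

/-- The `i`-th partial derivative, as a derivation of the algebra of smooth functions. -/
def partialD (i : Fin 8) : Derivation ℂ SmoothFn SmoothFn :=
  Derivation.mk'
    { toFun := fun φ => restrict (pd i (extend φ.1)) (contDiffOn_pd φ.2 i)
      map_add' := fun φ ψ => by
        ext p
        have h := pd_congr (F := extend (φ + ψ).1) (H := fun q => extend φ.1 q + extend ψ.1 q)
          (fun q hq => by simp [extend, hq]) i p.2
        refine h.trans ?_
        have h1 := differentiableAt_of_smoothOn φ.2 p.2
        have h2 := differentiableAt_of_smoothOn ψ.2 p.2
        rw [pd, (h1.fun_add h2).lineDeriv_eq_fderiv]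
        have h3 := fderiv_fun_add h1 h2
        simp [pd, h1.lineDeriv_eq_fderiv, h2.lineDeriv_eq_fderiv, h3]
      map_smul' := fun c φ => by
        ext p
        have h := pd_congr (F := extend (c • φ).1) (H := fun q => c * extend φ.1 q)
          (fun q hq => by simp [extend, hq]) i p.2
        refine h.trans ?_
        have hd := differentiableAt_of_smoothOn φ.2 p.2
        rw [pd, (hd.const_mul c).lineDeriv_eq_fderiv, fderiv_const_mul hd]
        simp [pd, hd.lineDeriv_eq_fderiv] }
    fun φ ψ => by
      ext p
      have h := pd_congr (F := extend (φ * ψ).1) (H := fun q => extend φ.1 q * extend ψ.1 q)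
        (fun q hq => by simp [extend, hq]) i p.2
      refine h.trans ?_
      have h1 := differentiableAt_of_smoothOn φ.2 p.2
      have h2 := differentiableAt_of_smoothOn ψ.2 p.2
      rw [pd, (h1.fun_mul h2).lineDeriv_eq_fderiv]
      have h3 := fderiv_fun_mul h1 h2
      simp [pd, h1.lineDeriv_eq_fderiv, h2.lineDeriv_eq_fderiv, h3, extend_apply]

lemma partialD_eq_pd {F : Coords → ℂ} {φ : SmoothFn} (h : ∀ p : chart, F p = φ.1 p) (i : Fin 8)
    (p : chart) : pd i F p = (partialD i φ).1 p :=
  pd_congr (fun q hq => by simpa [extend, hq] using h ⟨q, hq⟩) i p.2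

lemma partialD_comm (i j : Fin 8) (φ : SmoothFn) :
    partialD i (partialD j φ) = partialD j (partialD i φ) := by
  ext p
  rw [← partialD_eq_pd (F := pd j (extend φ.1)) (fun _ => rfl),
    ← partialD_eq_pd (F := pd i (extend φ.1)) (fun _ => rfl), pd_comm φ.2 i j p.2]

/-- A function of one real variable, evaluated at the `j`-th coordinate. -/
def ofCoord (j : Fin 8) (u : ℝ → ℝ) (hu : ContDiffOn ℝ ∞ (fun p : Coords => u (p j)) chart) :
    SmoothFn :=
  restrict (fun p => (u (p j) : ℂ)) (Complex.ofRealCLM.contDiff.comp_contDiffOn hu)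

lemma partialD_ofCoord (i j : Fin 8) (u v : ℝ → ℝ)
    (hu : ContDiffOn ℝ ∞ (fun p : Coords => u (p j)) chart)
    (hv : ContDiffOn ℝ ∞ (fun p : Coords => v (p j)) chart)
    (h : ∀ p ∈ chart, HasDerivAt u (v (p j)) (p j)) :
    partialD i (ofCoord j u hu) = if i = j then ofCoord j v hv else 0 := by
  ext p
  rw [← partialD_eq_pd (F := fun p => (u (p j) : ℂ)) (fun _ => rfl)]
  have h1 : HasFDerivAt (fun p : Coords => (u (p j) : ℂ)) _ p.1 :=
    (h p.1 p.2).ofReal_comp.hasFDerivAt.comp p.1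
      (ContinuousLinearMap.proj (R := ℝ) (φ := fun _ : Fin 8 => ℝ) j).hasFDerivAt
  rw [pd, h1.differentiableAt.lineDeriv_eq_fderiv, h1.fderiv]
  by_cases hij : i = j
  · subst hij; simp; rfl
  · simp [hij, Ne.symm hij]

lemma contDiff_apply_coord (j : Fin 8) : ContDiff ℝ ∞ (fun p : Coords => p j) :=
  contDiff_apply ℝ ℝ j

/-- The `j`-th coordinate as a smooth function. -/
def coordFn (j : Fin 8) : SmoothFn := ofCoord j (fun t => t) (contDiff_apply_coord j).contDiffOn

/-- The sine of the `j`-th coordinate. -/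
def sinFn (j : Fin 8) : SmoothFn :=
  ofCoord j Real.sin (Real.contDiff_sin.comp (contDiff_apply_coord j)).contDiffOn

/-- The cosine of the `j`-th coordinate. -/
def cosFn (j : Fin 8) : SmoothFn :=
  ofCoord j Real.cos (Real.contDiff_cos.comp (contDiff_apply_coord j)).contDiffOn

/-- The function `csc β`. -/
def cscFn : SmoothFn :=
  ofCoord iβ (fun t => (Real.sin t)⁻¹)
    ((Real.contDiff_sin.comp (contDiff_apply_coord iβ)).contDiffOn.inv fun _ hp => hp.2.2)

lemma partialD_coordFn (i j : Fin 8) : partialD i (coordFn j) = if i = j then 1 else 0 := by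
  rw [coordFn, partialD_ofCoord i j _ (fun _ => 1) _ contDiffOn_const
    fun p _ => hasDerivAt_id' _]
  split_ifs
  · ext p; simp [ofCoord]
  · rfl

lemma partialD_sinFn (i j : Fin 8) : partialD i (sinFn j) = if i = j then cosFn j else 0 :=
  partialD_ofCoord i j _ _ _ _ fun _ _ => Real.hasDerivAt_sin _

lemma partialD_cosFn (i j : Fin 8) : partialD i (cosFn j) = if i = j then -sinFn j else 0 := by
  rw [cosFn, partialD_ofCoord i j _ (fun t => -Real.sin t) _
    (Real.contDiff_sin.comp (contDiff_apply_coord j)).contDiffOn.neg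
    fun p _ => Real.hasDerivAt_cos _]
  split_ifs
  · ext p; simp [ofCoord, sinFn]
  · rfl

lemma sinFn_sq_add_cosFn_sq (j : Fin 8) : sinFn j ^ 2 + cosFn j ^ 2 = 1 := by
  ext p
  simp [sinFn, cosFn, ofCoord]

lemma sinFn_mul_cscFn : sinFn iβ * cscFn = 1 := by
  ext p
  have := p.2.2.2
  simp only [sinFn, cscFn, ofCoord]
  change ((Real.sin (p.1 iβ) : ℝ) : ℂ) * (((Real.sin (p.1 iβ))⁻¹ : ℝ) : ℂ) = 1
  rw [← Complex.ofReal_mul, mul_inv_cancel₀ this, Complex.ofReal_one]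

/-! ### Traces of conjugated matrices with noncommuting entries. -/

/-- The structure constants of the action of `E_{c,d} - E_{d,c}` for `d < c`, and zero otherwise. -/
def rotCoeff (c d a e : Fin 3) : ℤ :=
  if d < c then (if a = c ∧ e = d then 1 else if a = d ∧ e = c then -1 else 0) else 0

section Conjugation

variable {A : Type*} [Ring A] (K P : Matrix (Fin 3) (Fin 3) A)

/-- The conjugate `∑ K_{a,i} X K_{b,i}`. -/
def conjSum (a b : Fin 3) (X : A) : A := ∑ i, K a i * X * K b i

lemma conjSum_add (a b : Fin 3) (X Y : A) :
    conjSum K a b (X + Y) = conjSum K a b X + conjSum K a b Y := by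
  simp [conjSum, mul_add, add_mul, Finset.sum_add_distrib]

variable {K P}

lemma conjSum_one (hK : K * Kᵀ = 1) (a b : Fin 3) : conjSum K a b 1 = if a = b then 1 else 0 := by
  have := congrFun (congrFun hK a) b
  simpa [conjSum, Matrix.mul_apply, Matrix.one_apply] using this

/-- Moves one letter of `P` out of the conjugation, to the left. Iterating it empties the
conjugation, and orthogonality then evaluates what is left. -/
lemma conjSum_mul
    (hKP : ∀ c d a i, K a i * P c d = P c d * K a i - ∑ e, rotCoeff c d a e • K e i)
    (a b c d : Fin 3) (X : A) :
    conjSum K a b (P c d * X)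
      = P c d * conjSum K a b X - ∑ e, rotCoeff c d a e • conjSum K e b X := by
  simp only [conjSum, Finset.smul_sum, Finset.mul_sum, ← mul_assoc, hKP, sub_mul, Finset.sum_mul,
    Finset.sum_sub_distrib, smul_mul_assoc]
  congr 1
  exact Finset.sum_comm

lemma conjSum_self (hK : K * Kᵀ = 1)
    (hKP : ∀ c d a i, K a i * P c d = P c d * K a i - ∑ e, rotCoeff c d a e • K e i)
    (a b c d : Fin 3) :
    conjSum K a b (P c d) = (if a = b then P c d else 0) - (rotCoeff c d a b : A) := by
  have := conjSum_mul hKP a b c d 1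
  simpa [conjSum_one hK] using this

/-- The trace is not cyclic over a noncommutative ring, so the conjugation must stay inside the sum.
-/
lemma trace_conj (X : Matrix (Fin 3) (Fin 3) A) :
    trace (Kᵀ * X * K) = ∑ a, ∑ b, conjSum K a b (X a b) := by
  simp only [trace, diag, Matrix.mul_apply, conjSum, transpose_apply, Fin.sum_univ_three, add_mul]
  abel

lemma sum_conj_sq (hK : K * Kᵀ = 1) :
    ∑ i, ∑ j, (Kᵀ * P * K) i j * (Kᵀ * P * K) j i
      = ∑ a, ∑ b, conjSum K a b ((P * P) a b) := by
  have h : (Kᵀ * P * K) * (Kᵀ * P * K) = Kᵀ * (P * P) * K := by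
    simp only [mul_assoc]
    rw [← mul_assoc K Kᵀ, hK, one_mul]
  rw [← trace_conj, ← h]
  simp only [trace, diag, Matrix.mul_apply (M := Kᵀ * P * K)]

lemma sum_conj_cube (hK : K * Kᵀ = 1) :
    ∑ i, ∑ j, ∑ k, (Kᵀ * P * K) i j * ((Kᵀ * P * K) j k * (Kᵀ * P * K) k i)
      = ∑ a, ∑ b, conjSum K a b ((P * (P * P)) a b) := by
  have h : (Kᵀ * P * K) * ((Kᵀ * P * K) * (Kᵀ * P * K)) = Kᵀ * (P * (P * P)) * K := by
    simp only [mul_assoc]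
    rw [← mul_assoc K Kᵀ, hK, one_mul, ← mul_assoc K Kᵀ, hK, one_mul]
  rw [← trace_conj, ← h]
  simp only [trace, diag, Matrix.mul_apply (M := Kᵀ * P * K), Finset.mul_sum]

end Conjugation

/-! ### Normal ordering of the Casimir elements. -/

/-- The commutation relations between left-invariant vector fields on the Borel subgroup and
right-invariant vector fields on the rotation group. -/
structure IwasawaRelations {A : Type*} [Ring A] (h1 h2 n1 n2 n3 r0 r1 r2 : A) : Prop where
  h2_h1 : h2 * h1 = h1 * h2
  n1_h1 : n1 * h1 = h1 * n1 - n1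
  n1_h2 : n1 * h2 = h2 * n1
  n2_h1 : n2 * h1 = h1 * n2
  n2_h2 : n2 * h2 = h2 * n2 - n2
  n2_n1 : n2 * n1 = n1 * n2 + n3
  n3_h1 : n3 * h1 = h1 * n3 - n3
  n3_h2 : n3 * h2 = h2 * n3 - n3
  n3_n1 : n3 * n1 = n1 * n3
  n3_n2 : n3 * n2 = n2 * n3
  r0_h1 : r0 * h1 = h1 * r0
  r0_h2 : r0 * h2 = h2 * r0
  r0_n1 : r0 * n1 = n1 * r0
  r0_n2 : r0 * n2 = n2 * r0
  r0_n3 : r0 * n3 = n3 * r0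
  r1_h1 : r1 * h1 = h1 * r1
  r1_h2 : r1 * h2 = h2 * r1
  r1_n1 : r1 * n1 = n1 * r1
  r1_n2 : r1 * n2 = n2 * r1
  r1_n3 : r1 * n3 = n3 * r1
  r1_r0 : r1 * r0 = r0 * r1 - r2
  r2_h1 : r2 * h1 = h1 * r2
  r2_h2 : r2 * h2 = h2 * r2
  r2_n1 : r2 * n1 = n1 * r2
  r2_n2 : r2 * n2 = n2 * r2
  r2_n3 : r2 * n3 = n3 * r2
  r2_r0 : r2 * r0 = r0 * r2 + r1
  r2_r1 : r2 * r1 = r1 * r2 - r0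

/-- The derivatives along the elementary matrices, written with the Iwasawa vector fields. -/
def borelMatrix {A : Type*} [AddGroup A] (h1 h2 n1 n2 n3 r0 r1 r2 : A) : Matrix (Fin 3) (Fin 3) A :=
  !![h2, n2, n3; n2 + r0, h1 - h2, n1; n3 - r1, n1 + r2, -h1]

/-- The quadratic Casimir element, in normal order. -/
def quadraticCasimir {A : Type*} [Ring A] (h1 h2 n1 n2 n3 r0 r1 r2 : A) : A :=
  - 2 • h1 + 2 • (h1 * h1) - 2 • (h1 * h2) - 2 • h2 + 2 • (h2 * h2) + 2 • (n1 * n1)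
    + 2 • (n1 * r2) + 2 • (n2 * n2) + 2 • (n2 * r0) + 2 • (n3 * n3) - 2 • (n3 * r1)

/-- The cubic Casimir element, in normal order. -/
def cubicCasimir {A : Type*} [Ring A] (h1 h2 n1 n2 n3 r0 r1 r2 : A) : A :=
  - 6 • h1 + 6 • (h1 * h1) - 3 • (h1 * (h1 * h2)) - 3 • (h1 * h2) + 3 • (h1 * (h2 * h2))
    + 3 • (h1 * (n2 * n2)) + 3 • (h1 * (n2 * r0)) - 3 • (h1 * (n3 * n3))
    + 3 • (h1 * (n3 * r1)) - 3 • (h2 * (n1 * n1)) - 3 • (h2 * (n1 * r2))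
    + 3 • (h2 * (n3 * n3)) - 3 • (h2 * (n3 * r1)) + 6 • (n1 * n1) + 6 • (n1 * (n2 * n3))
    - 3 • (n1 * (n2 * r1)) + 3 • (n1 * (n3 * r0)) + 6 • (n1 * r2) + 3 • (n2 * (n3 * r2))
    + 6 • (n3 * n3) + 3 • (n3 * (r0 * r2)) - 3 • (n3 * r1)

/-- Lets a commutation relation rewrite inside a right-associated word, where its two letters are
followed by further factors. -/
lemma mul_assoc_rule {A : Type*} [Ring A] {a b c : A} (h : a * b = c) (x : A) :
    a * (b * x) = c * x := by rw [← mul_assoc, h]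

section Normal

variable {A : Type*} [Ring A] {K P : Matrix (Fin 3) (Fin 3) A} {h1 h2 n1 n2 n3 r0 r1 r2 : A}

/-- After `K` is eliminated, the relations serve as rewriting rules sorting each word into the order
`h1, h2, n1, n2, n3, r0, r1, r2`. -/
lemma sum_conj_sq_eq (h : IwasawaRelations h1 h2 n1 n2 n3 r0 r1 r2) (hK : K * Kᵀ = 1)
    (hKP : ∀ c d a i, K a i * P c d = P c d * K a i - ∑ e, rotCoeff c d a e • K e i)
    (hP : P = borelMatrix h1 h2 n1 n2 n3 r0 r1 r2 + diagonal ![0, 1, 2]) :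
    ∑ i, ∑ j, (Kᵀ * P * K) i j * (Kᵀ * P * K) j i
      = quadraticCasimir h1 h2 n1 n2 n3 r0 r1 r2 := by
  rw [sum_conj_sq hK, quadraticCasimir]
  simp only [Matrix.mul_apply, Fin.sum_univ_three, conjSum_add, conjSum_mul hKP,
    conjSum_self hK hKP,
    rotCoeff]
  simp only [Fin.isValue, Fin.reduceEq, Fin.reduceLT, if_true, if_false, true_and, and_true,
    and_false,
    false_and, zero_smul, one_smul, neg_smul, Int.cast_zero, Int.cast_one, Int.cast_neg, and_self]
  simp only [hP, borelMatrix, Matrix.add_apply, diagonal_apply, Matrix.of_apply, Matrix.cons_val,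
    Fin.isValue, Fin.reduceEq, if_true, if_false]
  obtain ⟨c0, c1, c2, c3, c4, c5, c6, c7, c8, c9, c10, c11, c12, c13, c14, c15, c16, c17, c18, c19,
    c20, c21, c22, c23, c24, c25, c26, c27⟩ := h
  simp only [mul_add, add_mul, mul_sub, sub_mul, mul_assoc, c0, mul_assoc_rule c0, c1,
    mul_assoc_rule c1, c2, mul_assoc_rule c2, c3, mul_assoc_rule c3, c4, mul_assoc_rule c4, c5,
    mul_assoc_rule c5, c6, mul_assoc_rule c6, c7, mul_assoc_rule c7, c8, mul_assoc_rule c8, c9,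
    mul_assoc_rule c9, c10, mul_assoc_rule c10, c11, mul_assoc_rule c11, c12, mul_assoc_rule c12,
    c13, mul_assoc_rule c13, c14, mul_assoc_rule c14, c15, mul_assoc_rule c15, c16,
    mul_assoc_rule c16, c17, mul_assoc_rule c17, c18, mul_assoc_rule c18, c19, mul_assoc_rule c19,
    c20, mul_assoc_rule c20, c21, mul_assoc_rule c21, c22, mul_assoc_rule c22, c23,
    mul_assoc_rule c23, c24, mul_assoc_rule c24, c25, mul_assoc_rule c25, c26, mul_assoc_rule c26,
    c27, mul_assoc_rule c27, mul_zero, zero_mul, mul_neg, neg_mul, mul_one, one_mul]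
  noncomm_ring

lemma sum_conj_cube_eq (h : IwasawaRelations h1 h2 n1 n2 n3 r0 r1 r2) (hK : K * Kᵀ = 1)
    (hKP : ∀ c d a i, K a i * P c d = P c d * K a i - ∑ e, rotCoeff c d a e • K e i)
    (hP : P = borelMatrix h1 h2 n1 n2 n3 r0 r1 r2 + diagonal ![0, 1, 2]) :
    ∑ i, ∑ j, ∑ k, (Kᵀ * P * K) i j * ((Kᵀ * P * K) j k * (Kᵀ * P * K) k i)
      = cubicCasimir h1 h2 n1 n2 n3 r0 r1 r2 := by
  rw [sum_conj_cube hK, cubicCasimir]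
  simp only [Matrix.mul_apply, Fin.sum_univ_three, mul_add, conjSum_add, conjSum_mul hKP,
    conjSum_self hK hKP, rotCoeff]
  simp only [Fin.isValue, Fin.reduceEq, Fin.reduceLT, if_true, if_false, true_and, and_true,
    and_false,
    false_and, zero_smul, one_smul, neg_smul, Int.cast_zero, Int.cast_one, Int.cast_neg, and_self]
  simp only [hP, borelMatrix, Matrix.add_apply, diagonal_apply, Matrix.of_apply, Matrix.cons_val,
    Fin.isValue, Fin.reduceEq, if_true, if_false]
  obtain ⟨c0, c1, c2, c3, c4, c5, c6, c7, c8, c9, c10, c11, c12, c13, c14, c15, c16, c17, c18, c19,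
    c20, c21, c22, c23, c24, c25, c26, c27⟩ := h
  simp only [mul_add, add_mul, mul_sub, sub_mul, mul_assoc, c0, mul_assoc_rule c0, c1,
    mul_assoc_rule c1, c2, mul_assoc_rule c2, c3, mul_assoc_rule c3, c4, mul_assoc_rule c4, c5,
    mul_assoc_rule c5, c6, mul_assoc_rule c6, c7, mul_assoc_rule c7, c8, mul_assoc_rule c8, c9,
    mul_assoc_rule c9, c10, mul_assoc_rule c10, c11, mul_assoc_rule c11, c12, mul_assoc_rule c12,
    c13, mul_assoc_rule c13, c14, mul_assoc_rule c14, c15, mul_assoc_rule c15, c16,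
    mul_assoc_rule c16, c17, mul_assoc_rule c17, c18, mul_assoc_rule c18, c19, mul_assoc_rule c19,
    c20, mul_assoc_rule c20, c21, mul_assoc_rule c21, c22, mul_assoc_rule c22, c23,
    mul_assoc_rule c23, c24, mul_assoc_rule c24, c25, mul_assoc_rule c25, c26, mul_assoc_rule c26,
    c27, mul_assoc_rule c27, mul_zero, zero_mul, mul_neg, neg_mul, mul_one, one_mul]
  noncomm_ring

end Normal

/-! ### The vector fields in Iwasawa coordinates. -/

lemma partialD_cscFn (i : Fin 8) :
    partialD i cscFn = if i = iβ then -(cscFn ^ 2 * cosFn iβ) else 0 := by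
  have h := Derivation.leibniz_of_mul_eq_one (partialD i) (a := cscFn) (b := sinFn iβ)
    (by rw [mul_comm, sinFn_mul_cscFn])
  rw [h, partialD_sinFn]
  split_ifs
  · simp only [smul_eq_mul]; ring
  · simp

/-- The left-invariant field `y₁ ∂_{y₁}`. -/
def fieldH1 : Derivation ℂ SmoothFn SmoothFn := coordFn iy1 • partialD iy1

/-- The left-invariant field `y₂ ∂_{y₂}`. -/
def fieldH2 : Derivation ℂ SmoothFn SmoothFn := coordFn iy2 • partialD iy2

/-- The left-invariant field `y₁ (∂_{x₁} + x₂ ∂_{x₃})`. -/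
def fieldN1 : Derivation ℂ SmoothFn SmoothFn :=
  coordFn iy1 • (partialD ix1 + coordFn ix2 • partialD ix3)

/-- The left-invariant field `y₂ ∂_{x₂}`. -/
def fieldN2 : Derivation ℂ SmoothFn SmoothFn := coordFn iy2 • partialD ix2

/-- The left-invariant field `y₁ y₂ ∂_{x₃}`. -/
def fieldN3 : Derivation ℂ SmoothFn SmoothFn := (coordFn iy1 * coordFn iy2) • partialD ix3

/-- The field `csc β ∂_γ - cot β ∂_α`. -/
def fieldCot : Derivation ℂ SmoothFn SmoothFn :=
  cscFn • partialD iγ - (cosFn iβ * cscFn) • partialD iα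

/-- The infinitesimal left rotation in the first two axes. -/
def fieldR0 : Derivation ℂ SmoothFn SmoothFn := partialD iα

/-- The infinitesimal left rotation in the first and the third axis. -/
def fieldR1 : Derivation ℂ SmoothFn SmoothFn :=
  cosFn iα • partialD iβ + sinFn iα • fieldCot

/-- The infinitesimal left rotation in the last two axes. -/
def fieldR2 : Derivation ℂ SmoothFn SmoothFn :=
  cosFn iα • fieldCot - sinFn iα • partialD iβ

-- The Borel fields and the rotation fields involve disjoint sets of variables, so they commute. The
-- other relations are brackets within each factor.
set_option maxHeartbeats 4000000 in
lemma iwasawaRelations_fields : IwasawaRelations (A := Module.End ℂ SmoothFn)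
    fieldH1 fieldH2 fieldN1 fieldN2 fieldN3 fieldR0 fieldR1 fieldR2 := by
  constructor <;> refine LinearMap.ext fun φ => ?_ <;>
    simp only [Module.End.mul_apply, LinearMap.add_apply, LinearMap.sub_apply, Derivation.coeFn_coe,
      fieldH1, fieldH2, fieldN1, fieldN2, fieldN3, fieldR0, fieldR1, fieldR2, fieldCot, ix1, ix2,
      ix3, iy1, iy2, iα, iβ, iγ, Derivation.smul_apply, Derivation.add_apply,
      Derivation.sub_apply, smul_eq_mul, map_add, map_sub, Derivation.leibniz, partialD_coordFn,
      partialD_sinFn, partialD_cosFn, partialD_cscFn, partialD_comm, Fin.isValue, Fin.reduceEq,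
      if_true, if_false]
  case r2_r1 =>
    -- The `β`-derivative of `cot β` leaves a multiple of `sin β csc β (sin² α + cos² α) ∂_α`, which
    -- must be recognised as `∂_α`.
    linear_combination (-partialD 5 φ * cscFn * sinFn 6) * sinFn_sq_add_cosFn_sq 5
      - partialD 5 φ * sinFn_mul_cscFn
  all_goals ring

/-! ### The matrices `b`, `k`, `g` and the action of the fields on them. -/

/-- A rotation in the first two axes. -/
def rotFn (c s : SmoothFn) : Matrix (Fin 3) (Fin 3) SmoothFn :=
  !![c, -s, 0; s, c, 0; 0, 0, 1]

/-- The rotation `w₃ k(-β,0,0) w₃`. -/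
def tiltFn : Matrix (Fin 3) (Fin 3) SmoothFn :=
  !![cosFn iβ, 0, sinFn iβ; 0, 1, 0; -sinFn iβ, 0, cosFn iβ]

/-- The rotation `k(α,β,γ)`, as a matrix of smooth functions. -/
def kFn : Matrix (Fin 3) (Fin 3) SmoothFn :=
  rotFn (cosFn iα) (sinFn iα) * tiltFn * rotFn (cosFn iγ) (sinFn iγ)

/-- The upper triangular factor `x y`, as a matrix of smooth functions. -/
def bFn : Matrix (Fin 3) (Fin 3) SmoothFn :=
  !![coordFn iy1 * coordFn iy2, coordFn ix2 * coordFn iy1, coordFn ix3;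
    0, coordFn iy1, coordFn ix1; 0, 0, 1]

/-- The matrix `x y k(α,β,γ)`, as a matrix of smooth functions. -/
def gFn : Matrix (Fin 3) (Fin 3) SmoothFn := bFn * kFn

lemma rotFn_mul_transpose {c s : SmoothFn} (h : s ^ 2 + c ^ 2 = 1) :
    rotFn c s * (rotFn c s)ᵀ = 1 := by
  ext1 i j
  fin_cases i <;> fin_cases j <;>
    simp only [rotFn, Matrix.mul_apply, Fin.sum_univ_three, transpose_apply, Matrix.of_apply,
      Matrix.cons_val, Fin.isValue, Matrix.one_apply, Fin.reduceEq, Fin.reduceFinMk, Fin.zero_eta,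
      Fin.mk_one, if_true, if_false] <;>
    first | ring1 | linear_combination h

lemma tiltFn_mul_transpose : tiltFn * tiltFnᵀ = 1 := by
  have h := sinFn_sq_add_cosFn_sq iβ
  ext1 i j
  fin_cases i <;> fin_cases j <;>
    simp only [tiltFn, Matrix.mul_apply, Fin.sum_univ_three, transpose_apply, Matrix.of_apply,
      Matrix.cons_val, Fin.isValue, Matrix.one_apply, Fin.reduceEq, Fin.reduceFinMk, Fin.zero_eta,
      Fin.mk_one, if_true, if_false] <;>
    first | ring1 | linear_combination h

lemma kFn_mul_transpose : kFn * kFnᵀ = 1 := by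
  rw [kFn, transpose_mul, transpose_mul]
  simp only [Matrix.mul_assoc]
  rw [← Matrix.mul_assoc (rotFn (cosFn iγ) _), rotFn_mul_transpose (sinFn_sq_add_cosFn_sq _),
    Matrix.one_mul, ← Matrix.mul_assoc tiltFn, tiltFn_mul_transpose, Matrix.one_mul,
    rotFn_mul_transpose (sinFn_sq_add_cosFn_sq _)]

lemma kFn_eq : kFn =
    !![cosFn iα * cosFn iβ * cosFn iγ - sinFn iα * sinFn iγ,
        -cosFn iα * cosFn iβ * sinFn iγ - sinFn iα * cosFn iγ, cosFn iα * sinFn iβ;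
      sinFn iα * cosFn iβ * cosFn iγ + cosFn iα * sinFn iγ,
        -sinFn iα * cosFn iβ * sinFn iγ + cosFn iα * cosFn iγ, sinFn iα * sinFn iβ;
      -sinFn iβ * cosFn iγ, sinFn iβ * sinFn iγ, cosFn iβ] := by
  ext1 i j
  fin_cases i <;> fin_cases j <;>
    simp only [kFn, tiltFn, rotFn, Matrix.mul_apply, Fin.sum_univ_three, Matrix.of_apply,
      Matrix.cons_val, Fin.isValue, Fin.reduceFinMk, Fin.zero_eta, Fin.mk_one] <;>
    ring

-- This identifies the coordinate expressions of the rotation fields: they are the left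
-- multiplications of `k` by `E_{2,1} - E_{1,2}`, `E_{1,3} - E_{3,1}` and `E_{3,2} - E_{2,3}`. The
-- orientation of the second explains the sign of `r1` in `borelMatrix`.
set_option maxHeartbeats 4000000 in
lemma field_kFn (a i : Fin 3) : fieldH1 (kFn a i) = 0 ∧ fieldH2 (kFn a i) = 0 ∧
    fieldN1 (kFn a i) = 0 ∧ fieldN2 (kFn a i) = 0 ∧ fieldN3 (kFn a i) = 0 ∧
    fieldR0 (kFn a i) = ![-kFn 1 i, kFn 0 i, 0] a ∧
    fieldR1 (kFn a i) = ![kFn 2 i, 0, -kFn 0 i] a ∧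
    fieldR2 (kFn a i) = ![0, -kFn 2 i, kFn 1 i] a := by
  have hα : sinFn 5 ^ 2 + cosFn 5 ^ 2 = 1 := sinFn_sq_add_cosFn_sq iα
  have hβ : sinFn 6 ^ 2 + cosFn 6 ^ 2 = 1 := sinFn_sq_add_cosFn_sq iβ
  have hc : sinFn 6 * cscFn = 1 := sinFn_mul_cscFn
  simp only [kFn_eq]
  fin_cases a <;> fin_cases i <;> refine ⟨?_, ?_, ?_, ?_, ?_, ?_, ?_, ?_⟩ <;>
    simp only [fieldH1, fieldH2, fieldN1, fieldN2, fieldN3, fieldR0, fieldR1, fieldR2, fieldCot,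
      ix1, ix2, ix3, iy1, iy2, iα, iβ, iγ, Derivation.smul_apply, Derivation.add_apply,
      Derivation.sub_apply, smul_eq_mul, map_add, map_sub, map_neg, Derivation.leibniz,
      partialD_sinFn, partialD_cosFn, Fin.isValue, Fin.reduceEq, if_true, if_false,
      Matrix.of_apply, Matrix.cons_val, Fin.reduceFinMk, Fin.zero_eta, Fin.mk_one] <;>
    try ring1
  all_goals grind

lemma field_bFn (c e : Fin 3) : fieldH1 (bFn c e) = ![bFn c 0, bFn c 1, 0] e ∧
    fieldH2 (bFn c e) = ![bFn c 0, 0, 0] e ∧ fieldN1 (bFn c e) = ![0, 0, bFn c 1] e ∧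
    fieldN2 (bFn c e) = ![0, bFn c 0, 0] e ∧ fieldN3 (bFn c e) = ![0, 0, bFn c 0] e ∧
    fieldR0 (bFn c e) = 0 ∧ fieldR1 (bFn c e) = 0 ∧ fieldR2 (bFn c e) = 0 := by
  fin_cases c <;> fin_cases e <;> refine ⟨?_, ?_, ?_, ?_, ?_, ?_, ?_, ?_⟩ <;>
    simp only [bFn, fieldH1, fieldH2, fieldN1, fieldN2, fieldN3, fieldR0, fieldR1, fieldR2,
      fieldCot, ix1, ix2, ix3, iy1, iy2, iα, iβ, iγ, Derivation.smul_apply, Derivation.add_apply,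
      Derivation.sub_apply, smul_eq_mul, map_zero, Derivation.map_one_eq_zero, Derivation.leibniz,
      partialD_coordFn, Fin.isValue, Fin.reduceEq, if_true, if_false,
      Matrix.of_apply, Matrix.cons_val, Fin.reduceFinMk, Fin.zero_eta, Fin.mk_one] <;>
    try ring1

/-- The derivatives along the elementary matrices, as derivations. -/
def fieldMatrix : Matrix (Fin 3) (Fin 3) (Derivation ℂ SmoothFn SmoothFn) :=
  borelMatrix fieldH1 fieldH2 fieldN1 fieldN2 fieldN3 fieldR0 fieldR1 fieldR2

lemma fieldMatrix_kFn (c d a i : Fin 3) :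
    fieldMatrix c d (kFn a i) = ∑ e, rotCoeff c d a e • kFn e i := by
  obtain ⟨h1, h2, n1, n2, n3, r0, r1, r2⟩ := field_kFn a i
  fin_cases c <;> fin_cases d <;>
    simp [fieldMatrix, borelMatrix, h1, h2, n1, n2, n3, r0, r1, r2, rotCoeff,
      Fin.sum_univ_three] <;>
    fin_cases a <;> simp

/-- The expected value is the entry of `b E_{a,b} k`. The correction at the last diagonal entry
arises because `-h1` represents `E_{3,3}` only modulo the identity matrix. -/
lemma fieldMatrix_gFn (a b c d : Fin 3) :
    fieldMatrix a b (gFn c d) = bFn c a * kFn b d - if a = 2 ∧ b = 2 then gFn c d else 0 := by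
  have hg : gFn c d = ∑ e, bFn c e * kFn e d := rfl
  have hb := field_bFn c
  have hk := fun e => field_kFn e d
  simp only [forall_and] at hb hk
  obtain ⟨b1, b2, b3, b4, b5, b6, b7, b8⟩ := hb
  obtain ⟨k1, k2, k3, k4, k5, k6, k7, k8⟩ := hk
  rw [hg, Fin.sum_univ_three]
  fin_cases a <;> fin_cases b <;>
    simp [fieldMatrix, borelMatrix, b1, b2, b3, b4, b5, b6, b7, b8, k1, k2, k3, k4, k5, k6, k7,
      k8] <;>
    try ring1

/-! ### The operators `Kᵀ P K`. -/

/-- Multiplication by the entries of `k(α,β,γ)`. -/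
def kOp : Matrix (Fin 3) (Fin 3) (Module.End ℂ SmoothFn) := kFn.map (LinearMap.mulLeft ℂ)

/-- The derivatives along the elementary matrices, corrected by the rotation of `k(α,β,γ)`. -/
def fieldOp : Matrix (Fin 3) (Fin 3) (Module.End ℂ SmoothFn) :=
  fieldMatrix.map (fun D => (D : SmoothFn →ₗ[ℂ] SmoothFn)) + diagonal ![0, 1, 2]

/-- The conjugated derivative along `E_{i,j}`, as an operator on smooth functions on the chart. -/
def chartE : Matrix (Fin 3) (Fin 3) (Module.End ℂ SmoothFn) :=
  kOpᵀ * fieldOp * kOp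

lemma kOp_mul_transpose : kOp * kOpᵀ = 1 := by
  ext1 a b
  refine LinearMap.ext fun φ => ?_
  have h := congrFun (congrFun kFn_mul_transpose a) b
  have h' : (∑ i, kFn a i * kFn b i) * φ = (1 : Matrix (Fin 3) (Fin 3) SmoothFn) a b * φ :=
    congrArg (· * φ) h
  simp only [kOp, Matrix.mul_apply, transpose_apply, Matrix.map_apply, LinearMap.sum_apply,
    Module.End.mul_apply, LinearMap.mulLeft_apply, ← mul_assoc, ← Finset.sum_mul, h']
  rw [Matrix.one_apply, Matrix.one_apply]
  split_ifs <;> simp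

/-- This is the Leibniz rule for the entries of `k`; the diagonal correction is scalar and commutes
with them. -/
lemma kOp_mul_fieldOp (c d a i : Fin 3) :
    kOp a i * fieldOp c d = fieldOp c d * kOp a i - ∑ e, rotCoeff c d a e • kOp e i := by
  refine LinearMap.ext fun φ => ?_
  have h := fieldMatrix_kFn c d a i
  have hn : ∀ n : Fin 3 → Module.End ℂ SmoothFn, n = ![0, 1, 2] → ∀ e (x y : SmoothFn),
      n e (x * y) = x * n e y := by
    rintro n rfl e x y
    fin_cases e
    · simp
    · simp
    · change (2 : Module.End ℂ SmoothFn) (x * y) = x * (2 : Module.End ℂ SmoothFn) y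
      simp [← one_add_one_eq_two, mul_add]
  have hd : (diagonal ![0, 1, 2] : Matrix (Fin 3) (Fin 3) (Module.End ℂ SmoothFn)) c d
        (kFn a i * φ)
      = kFn a i * (diagonal ![0, 1, 2] : Matrix (Fin 3) (Fin 3) (Module.End ℂ SmoothFn)) c d φ := by
    by_cases hcd : c = d
    · subst hcd
      simpa only [diagonal_apply_eq] using hn _ rfl c _ _
    · simp [hcd]
  simp only [kOp, fieldOp, Module.End.mul_apply, LinearMap.sub_apply, Matrix.add_apply,
    LinearMap.add_apply,
    Matrix.map_apply, LinearMap.mulLeft_apply, Derivation.coeFn_coe, Derivation.leibniz, hd, h,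
    LinearMap.sum_apply, LinearMap.smul_apply, smul_eq_mul, Finset.mul_sum, mul_add]
  rw [Finset.sum_congr rfl fun e _ => show φ * (rotCoeff c d a e • kFn e i)
    = rotCoeff c d a e • (kFn e i * φ) by rw [mul_smul_comm, mul_comm]]
  ring

/-- In row `a`, each of the entries with `b < a` differentiates `k_{b,j}` into `-k_{a,j}`. There are
`0`, `1`, `2` such entries in the three rows, which is exactly what `diagonal ![0, 1, 2]` restores.
-/
lemma chartE_apply (i j : Fin 3) (φ : SmoothFn) :
    chartE i j φ = ∑ a, ∑ b, kFn a i * kFn b j * fieldMatrix a b φ := by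
  simp only [chartE, kOp, fieldOp, Matrix.mul_apply, transpose_apply, Matrix.map_apply,
    Matrix.add_apply,
    LinearMap.sum_apply, Module.End.mul_apply, LinearMap.add_apply, LinearMap.mulLeft_apply,
    Derivation.coeFn_coe, Derivation.leibniz, fieldMatrix_kFn, Fin.sum_univ_three, rotCoeff,
    diagonal_apply]
  simp only [Fin.isValue, Fin.reduceEq, Fin.reduceLT, if_true, if_false, true_and, and_true,
    and_false, false_and, zero_smul, one_smul, neg_smul, and_self, smul_eq_mul, Matrix.cons_val,
    LinearMap.zero_apply, Module.End.one_apply]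
  have h2 : ∀ x : SmoothFn, (2 : Module.End ℂ SmoothFn) x = 2 * x := fun x => by
    simp [← one_add_one_eq_two, add_mul]
  simp only [h2]
  ring

/-! ### Differentiation on the group through the nine matrix entries. -/

/-- The pullback of a function on `G`, as a function of the nine matrix entries. -/
def lift (f : G → ℂ) (A : Fin 3 → Fin 3 → ℝ) : ℂ := pullback f (Matrix.of A)

lemma isOpen_det_ne_zero : IsOpen {A : Fin 3 → Fin 3 → ℝ | (Matrix.of A).det ≠ 0} :=
  isOpen_ne_fun (Continuous.matrix_det (continuous_id : Continuous fun A : Matrix (Fin 3) (Fin 3) ℝ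
    => A))
    continuous_const

lemma hasFDerivAt_lift {f : G → ℂ} (hf : IsSmooth f) {A : Fin 3 → Fin 3 → ℝ}
    (hA : (Matrix.of A).det ≠ 0) : HasFDerivAt (lift f) (fderiv ℝ (lift f) A) A :=
  ((ContDiffOn.contDiffAt hf (isOpen_det_ne_zero.mem_nhds hA)).differentiableAt
    (by simp)).hasFDerivAt

lemma lift_mul (f : G → ℂ) (A : Fin 3 → Fin 3 → ℝ) (hA : (Matrix.of A).det ≠ 0) (u : GL (Fin 3) ℝ) :
    lift f (fun c d => ∑ l, A c l * u.1 l d)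
      = f (ProjGenLinGroup.mk (GeneralLinearGroup.mkOfDetNeZero (Matrix.of A) hA)
          * ProjGenLinGroup.mk u) := by
  have h1 : Matrix.of (fun c d => ∑ l, A c l * u.1 l d) = Matrix.of A * u.1 := rfl
  have h2 : (Matrix.of A * u.1).det ≠ 0 := by
    rw [det_mul]
    exact mul_ne_zero hA (u.1.isUnit_iff_isUnit_det.1 u.isUnit).ne_zero
  rw [lift, h1, pullback, dif_pos h2, ← map_mul]
  congr 2
  ext1
  rfl

lemma lift_smul (f : G → ℂ) (A : Fin 3 → Fin 3 → ℝ) {c : ℝ} (hc : c ≠ 0) :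
    lift f (c • A) = lift f A := by
  by_cases hA : (Matrix.of A).det ≠ 0
  · have h := lift_mul f A hA (GeneralLinearGroup.scalar (Fin 3) (Units.mk0 c hc))
    rw [ProjGenLinGroup.mk_scalar, mul_one] at h
    have hA' : lift f A
        = f (ProjGenLinGroup.mk (GeneralLinearGroup.mkOfDetNeZero (Matrix.of A) hA)) := by
      rw [lift, pullback, dif_pos hA]
    rw [hA', ← h]
    congr 1
    ext i j
    simp [Matrix.scalar_apply, Matrix.diagonal_apply, mul_comm]
  -- On singular matrices both sides are the default value zero.
  · have h2 : ¬ (Matrix.of (c • A)).det ≠ 0 := by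
      have : Matrix.of (c • A) = c • Matrix.of A := rfl
      rw [this, det_smul]
      simpa [hc] using hA
    rw [lift, pullback, dif_neg h2, lift, pullback, dif_neg hA]

/-- Euler's relation: the pullback is homogeneous of degree zero, hence constant along the ray
through `A`. -/
lemma fderiv_lift_self {f : G → ℂ} (hf : IsSmooth f) {A : Fin 3 → Fin 3 → ℝ}
    (hA : (Matrix.of A).det ≠ 0) : fderiv ℝ (lift f) A A = 0 := by
  have h1 : HasDerivAt (fun t : ℝ => t • A) A 1 := by
    simpa using (hasDerivAt_id (1 : ℝ)).smul_const A
  have h2 : HasFDerivAt (lift f) (fderiv ℝ (lift f) A) ((1 : ℝ) • A) := by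
    simpa using hasFDerivAt_lift hf hA
  have h3 := h2.comp_hasDerivAt (1 : ℝ) h1
  refine h3.unique ((hasDerivAt_const (1 : ℝ) (lift f A)).congr_of_eventuallyEq ?_)
  filter_upwards [isOpen_ne.mem_nhds (one_ne_zero : (1 : ℝ) ≠ 0)] with t ht
  exact lift_smul f A ht

lemma hasDerivAt_exp_entry (X : Matrix (Fin 3) (Fin 3) ℝ) (l d : Fin 3) :
    HasDerivAt (fun t : ℝ => NormedSpace.exp (t • X) l d) (X l d) 0 := by
  open scoped Norms.Operator in
  have h := hasDerivAt_exp_smul_const (𝕂 := ℝ) X (0 : ℝ)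
  rw [zero_smul, NormedSpace.exp_zero, one_mul] at h
  exact (LinearMap.toContinuousLinearMap (Matrix.entryLinearMap ℝ ℝ l
    d)).hasFDerivAt.comp_hasDerivAt
    (0 : ℝ) h

lemma lift_lieAct {f : G → ℂ} (hf : IsSmooth f) (X : Matrix (Fin 3) (Fin 3) ℝ)
    {A : Fin 3 → Fin 3 → ℝ} (hA : (Matrix.of A).det ≠ 0) :
    lift (lieAct X f) A = fderiv ℝ (lift f) A (fun c d => ∑ l, A c l * X l d) := by
  have h1 : HasDerivAt (fun t : ℝ => fun c d => ∑ l, A c l * NormedSpace.exp (t • X) l d)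
      (fun c d => ∑ l, A c l * X l d) 0 :=
    hasDerivAt_pi.2 fun c => hasDerivAt_pi.2 fun d =>
      HasDerivAt.fun_sum fun l _ => (hasDerivAt_exp_entry X l d).const_mul _
  have h0 : (fun c d => ∑ l, A c l * NormedSpace.exp ((0 : ℝ) • X) l d) = A := by
    ext c d
    simp [NormedSpace.exp_zero, Matrix.one_apply]
  have h2 : HasFDerivAt (lift f) (fderiv ℝ (lift f) A)
      (fun c d => ∑ l, A c l * NormedSpace.exp ((0 : ℝ) • X) l d) := by
    rw [h0]; exact hasFDerivAt_lift hf hA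
  have h3 := (h2.comp_hasDerivAt (0 : ℝ) h1).deriv
  rw [← h3, lift, pullback, dif_pos hA, lieAct]
  congr 1
  ext t
  exact (lift_mul f A hA (Matrix.isUnit_exp (t • X)).unit).symm

/-- `A E_{i,j}` has column `i` of `A` in place `j` and zeros elsewhere. The formula has polynomial
coefficients, so it also shows that `E_{i,j}` preserves smoothness and can be iterated. -/
lemma lift_E {f : G → ℂ} (hf : IsSmooth f) (i j : Fin 3) {A : Fin 3 → Fin 3 → ℝ}
    (hA : (Matrix.of A).det ≠ 0) :
    lift (E i j f) A = ∑ c, (A c i : ℂ) * fderiv ℝ (lift f) A (Pi.single c (Pi.single j 1)) := by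
  have h : (fun c d => ∑ l, A c l * Matrix.single i j (1 : ℝ) l d)
      = ∑ c, A c i • (Pi.single c (Pi.single j 1) : Fin 3 → Fin 3 → ℝ) := by
    ext c d
    simp [Matrix.single_apply, Finset.sum_apply, Pi.single_apply, ite_and]
    fin_cases c <;> simp [Fin.sum_univ_three, Pi.single_apply, eq_comm]
  rw [E, lift_lieAct hf _ hA, h, map_sum]
  simp

lemma isSmooth_E {f : G → ℂ} (hf : IsSmooth f) (i j : Fin 3) : IsSmooth (E i j f) := by
  have h : ContDiffOn ℝ ∞ (fderiv ℝ (lift f)) {A | (Matrix.of A).det ≠ 0} :=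
    ContDiffOn.fderiv_of_isOpen hf isOpen_det_ne_zero (by simp)
  refine ContDiffOn.congr (f := fun A => ∑ c, (A c i : ℂ) *
    fderiv ℝ (lift f) A (Pi.single c (Pi.single j 1))) ?_ fun A hA => lift_E hf i j hA
  refine ContDiffOn.sum fun c _ => ContDiffOn.mul ?_ (h.clm_apply contDiffOn_const)
  exact (Complex.ofRealCLM.contDiff.comp
    ((contDiff_apply ℝ ℝ i).comp (contDiff_apply ℝ (Fin 3 → ℝ) c))).contDiffOn

/-! ### The chain rule through the Iwasawa coordinates. -/

lemma det_iwasawa (p : Coords) : (iwasawa p).det = p iy1 ^ 2 * p iy2 := by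
  have hr : ∀ θ, (rotZ θ).det = 1 := fun θ => by
    rw [rotZ, det_fin_three]
    simp [← sq]
  have hw : w3.det = 1 := by
    rw [w3, det_fin_three]
    simp
  rw [iwasawa, matK, det_mul, det_mul, det_mul, det_mul, det_mul, det_mul, hr, hr, hr, hw, matX,
    matY, det_fin_three, det_fin_three]
  simp
  ring

lemma det_iwasawa_ne_zero {p : Coords} (hp : p ∈ chart) : (iwasawa p).det ≠ 0 := by
  rw [det_iwasawa]
  exact (mul_pos (pow_pos hp.1 2) hp.2.1).ne'

/-- The matrix with given Iwasawa coordinates, as an array of real numbers. -/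
def iwasawaArray (p : Coords) : Fin 3 → Fin 3 → ℝ := fun c d => iwasawa p c d

lemma contDiff_iwasawaArray : ContDiff ℝ ∞ iwasawaArray := by
  refine contDiff_pi.2 fun c => contDiff_pi.2 fun d => ?_
  fin_cases c <;> fin_cases d <;>
    simp only [iwasawaArray, iwasawa, matX, matY, matK, rotZ, w3, Matrix.mul_apply,
      Fin.sum_univ_three,
      Matrix.of_apply, Matrix.cons_val, Fin.isValue, Fin.reduceFinMk, Fin.zero_eta, Fin.mk_one] <;>
    fun_prop

lemma gFn_apply (c d : Fin 3) (p : chart) : (gFn c d).1 p = (iwasawaArray p c d : ℂ) := by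
  have hx : ∀ j, (coordFn j).1 p = ((p.1 j : ℝ) : ℂ) := fun _ => rfl
  have hs : ∀ j, (sinFn j).1 p = ((Real.sin (p.1 j) : ℝ) : ℂ) := fun _ => rfl
  have hc : ∀ j, (cosFn j).1 p = ((Real.cos (p.1 j) : ℝ) : ℂ) := fun _ => rfl
  fin_cases c <;> fin_cases d <;>
    simp [gFn, bFn, kFn_eq, hx, hs, hc, iwasawaArray, iwasawa, matX, matY, matK, rotZ, w3,
      Matrix.mul_apply,
      Fin.sum_univ_three, -Complex.ofReal_sin, -Complex.ofReal_cos] <;>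
    first | done | ring1 | (left; ring1)

/-- A smooth function on `G` in the Iwasawa coordinates. -/
def chartFn (f : G → ℂ) (hf : IsSmooth f) : SmoothFn :=
  restrict (inCoords f) (ContDiffOn.comp (g := lift f) hf contDiff_iwasawaArray.contDiffOn
    fun _ hp => det_iwasawa_ne_zero hp)

/-- The derivative of a smooth function on `G` in the direction of an elementary matrix. -/
def gradFn (f : G → ℂ) (hf : IsSmooth f) (c d : Fin 3) : SmoothFn :=
  restrict (fun p => fderiv ℝ (lift f) (iwasawaArray p) (Pi.single c (Pi.single d 1)))
    ((ContDiffOn.comp (g := fderiv ℝ (lift f))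
      (ContDiffOn.fderiv_of_isOpen hf isOpen_det_ne_zero (by simp)) contDiff_iwasawaArray.contDiffOn
      fun _ hp => det_iwasawa_ne_zero hp).clm_apply contDiffOn_const)

lemma eq_sum_single (v : Fin 3 → Fin 3 → ℝ) :
    v = ∑ c, ∑ d, v c d • (Pi.single c (Pi.single d 1) : Fin 3 → Fin 3 → ℝ) := by
  ext a b
  fin_cases a <;> fin_cases b <;> simp [Fin.sum_univ_three, Pi.single_apply]

lemma fderiv_lift_eq_sum (f : G → ℂ) (A v : Fin 3 → Fin 3 → ℝ) :
    fderiv ℝ (lift f) A v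
      = ∑ c, ∑ d, (v c d : ℂ) * fderiv ℝ (lift f) A (Pi.single c (Pi.single d 1)) := by
  conv_lhs => rw [eq_sum_single v]
  simp

lemma partialD_chartFn (f : G → ℂ) (hf : IsSmooth f) (m : Fin 8) :
    partialD m (chartFn f hf) = ∑ c, ∑ d, partialD m (gFn c d) * gradFn f hf c d := by
  ext p
  have hd := (contDiff_iwasawaArray.differentiable (by simp) p.1).hasFDerivAt
  have hv : ∀ c d, (partialD m (gFn c d)).1 p
      = ((fderiv ℝ iwasawaArray p.1 (Pi.single m 1) c d : ℝ)
        : ℂ) := by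
    intro c d
    rw [← partialD_eq_pd (F := fun p => (iwasawaArray p c d : ℂ))
      (fun q => (gFn_apply c d q).symm)]
    have h2 := (hasFDerivAt_pi'.1 ((hasFDerivAt_pi'.1 hd) c)) d
    have h3 := Complex.ofRealCLM.hasFDerivAt.comp p.1 h2
    exact (h3.hasLineDerivAt (Pi.single m 1)).lineDeriv
  rw [← partialD_eq_pd (F := inCoords f) (fun _ => rfl)]
  have h4 := (hasFDerivAt_lift hf (A := iwasawaArray p) (det_iwasawa_ne_zero p.2)).comp p.1 hd
  refine (h4.hasLineDerivAt (Pi.single m 1)).lineDeriv.trans ?_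
  rw [ContinuousLinearMap.comp_apply, fderiv_lift_eq_sum]
  simp only [← hv]
  simp [gradFn]

/-- The chain rule along a derivation, for a function on `G`. -/
def ChainRule (f : G → ℂ) (hf : IsSmooth f) (D : Derivation ℂ SmoothFn SmoothFn) : Prop :=
  D (chartFn f hf) = ∑ c, ∑ d, D (gFn c d) * gradFn f hf c d

/-- The chain rule is linear over smooth functions in the derivation, so the coordinate derivatives
suffice. -/
lemma chainRule_fieldMatrix (f : G → ℂ) (hf : IsSmooth f) (a b : Fin 3) :
    ChainRule f hf (fieldMatrix a b) := by
  have hp : ∀ m, ChainRule f hf (partialD m) := partialD_chartFn f hf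
  have ha : ∀ {D D'}, ChainRule f hf D → ChainRule f hf D' → ChainRule f hf (D + D') := by
    intro D D' h h'
    simp only [ChainRule] at h h'
    simp only [ChainRule, Derivation.add_apply, h, h', add_mul, Finset.sum_add_distrib]
  have hs : ∀ {D D'}, ChainRule f hf D → ChainRule f hf D' → ChainRule f hf (D - D') := by
    intro D D' h h'
    simp only [ChainRule] at h h'
    simp only [ChainRule, Derivation.sub_apply, h, h', sub_mul, Finset.sum_sub_distrib]
  have hn : ∀ {D}, ChainRule f hf D → ChainRule f hf (-D) := by
    intro D h
    simp only [ChainRule] at h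
    simp only [ChainRule, Derivation.neg_apply, h, Fin.sum_univ_three]
    ring
  have hm : ∀ (r : SmoothFn) {D}, ChainRule f hf D → ChainRule f hf (r • D) := by
    intro r D h
    simp only [ChainRule] at h
    simp only [ChainRule, Derivation.smul_apply, h, smul_eq_mul, Finset.mul_sum, mul_assoc]
  have e1 : ChainRule f hf fieldH1 := hm _ (hp _)
  have e2 : ChainRule f hf fieldH2 := hm _ (hp _)
  have e3 : ChainRule f hf fieldN1 := hm _ (ha (hp _) (hm _ (hp _)))
  have e4 : ChainRule f hf fieldN2 := hm _ (hp _)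
  have e5 : ChainRule f hf fieldN3 := hm _ (hp _)
  have e6 : ChainRule f hf fieldCot := hs (hm _ (hp _)) (hm _ (hp _))
  have e7 : ChainRule f hf fieldR0 := hp _
  have e8 : ChainRule f hf fieldR1 := ha (hm _ (hp _)) (hm _ e6)
  have e9 : ChainRule f hf fieldR2 := hs (hm _ e6) (hm _ (hp _))
  fin_cases a <;> fin_cases b
  exacts [e2, e4, e5, ha e4 e7, hs e1 e2, e3, hs e5 e8, ha e3 e9, hn e1]

lemma sum_gFn_mul_gradFn (f : G → ℂ) (hf : IsSmooth f) :
    ∑ c, ∑ d, gFn c d * gradFn f hf c d = 0 := by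
  ext p
  have h := fderiv_lift_self hf (A := iwasawaArray p) (det_iwasawa_ne_zero p.2)
  rw [fderiv_lift_eq_sum] at h
  simp only [← gFn_apply] at h
  simpa [gradFn] using h

lemma fieldMatrix_chartFn (f : G → ℂ) (hf : IsSmooth f) (a b : Fin 3) :
    fieldMatrix a b (chartFn f hf) = ∑ c, ∑ d, bFn c a * kFn b d * gradFn f hf c d := by
  have h : fieldMatrix a b (chartFn f hf)
    = ∑ c, ∑ d, fieldMatrix a b (gFn c d) * gradFn f hf c d := chainRule_fieldMatrix f hf a b
  rw [h]
  simp only [fieldMatrix_gFn, sub_mul, Finset.sum_sub_distrib]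
  split_ifs
  · rw [sum_gFn_mul_gradFn, sub_zero]
  · simp

lemma chartFn_E (f : G → ℂ) (hf : IsSmooth f) (i j : Fin 3) :
    chartFn (E i j f) (isSmooth_E hf i j) = chartE i j (chartFn f hf) := by
  have h1 : chartFn (E i j f) (isSmooth_E hf i j) = ∑ c, gFn c i * gradFn f hf c j := by
    ext p
    have h := lift_E hf i j (A := iwasawaArray p) (det_iwasawa_ne_zero p.2)
    simp only [← gFn_apply] at h
    refine h.trans ?_
    simp [gradFn]
  have hk : ∀ d, ∑ b, kFn b j * kFn b d = if j = d then 1 else 0 := fun d => by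
    have := congrFun (congrFun (mul_eq_one_comm.1 kFn_mul_transpose : kFnᵀ * kFn = 1) j) d
    simpa [Matrix.mul_apply, Matrix.one_apply] using this
  rw [h1, chartE_apply]
  -- Inserting `kᵀ k = 1` turns the derivative along column `j` into the combination of the
  -- `M_{a,b}` that defines `chartE`.
  calc _ = ∑ c, ∑ d, gFn c i * (∑ b, kFn b j * kFn b d) * gradFn f hf c d := by
        simp [hk]
    _ = _ := by
      simp only [fieldMatrix_chartFn, gFn, Matrix.mul_apply, Fin.sum_univ_three]
      ring

/-! ### The coordinate operators as polynomials in the fields. -/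

/-- The operator `T` on functions of the Iwasawa coordinates acts on smooth functions on the chart
as `T'`. -/
def ActsAs (T : Op) (T' : Module.End ℂ SmoothFn) : Prop :=
  ∀ (F : Coords → ℂ) (φ : SmoothFn), (∀ p : chart, F p = φ.1 p) → ∀ p : chart, T F p = (T' φ).1 p

namespace ActsAs

variable {T S : Op} {T' S' : Module.End ℂ SmoothFn}

lemma comp (hT : ActsAs T T') (hS : ActsAs S S') : ActsAs (T ∘ S) (T' * S') :=
  fun F φ h p => hT (S F) (S' φ) (hS F φ h) p

lemma add (hT : ActsAs T T') (hS : ActsAs S S') : ActsAs (T + S) (T' + S') :=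
  fun F φ h p => congrArg₂ (· + ·) (hT F φ h p) (hS F φ h p)

lemma sub (hT : ActsAs T T') (hS : ActsAs S S') : ActsAs (T - S) (T' - S') :=
  fun F φ h p => congrArg₂ (· - ·) (hT F φ h p) (hS F φ h p)

lemma smul (c : ℂ) (hT : ActsAs T T') : ActsAs (c • T) (c • T') :=
  fun F φ h p => congrArg (c * ·) (hT F φ h p)

lemma id : ActsAs id 1 := fun _ _ h p => h p

end ActsAs

lemma actsAs_pd (i : Fin 8) : ActsAs (pd i) (partialD i : SmoothFn →ₗ[ℂ] SmoothFn) :=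
  fun _ _ h p => partialD_eq_pd h i p

lemma coordFn_apply (j : Fin 8) (p : chart) : (coordFn j).1 p = (p.1 j : ℂ) := rfl

lemma sinFn_apply (j : Fin 8) (p : chart) : (sinFn j).1 p = Complex.sin (p.1 j) :=
  Complex.ofReal_sin _

lemma cosFn_apply (j : Fin 8) (p : chart) : (cosFn j).1 p = Complex.cos (p.1 j) :=
  Complex.ofReal_cos _

lemma cscFn_apply (p : chart) : cscFn.1 p = (Complex.sin (p.1 iβ))⁻¹ := by
  rw [← Complex.ofReal_sin, ← Complex.ofReal_inv]; rfl

lemma actsAs_KL0 : ActsAs KL0 (-(Real.sqrt 2 : ℂ) • (fieldR0 : Module.End ℂ SmoothFn)) := by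
  intro F φ h p
  simp [KL0, actsAs_pd _ F φ h p, fieldR0]

lemma actsAs_KL1_one : ActsAs (KL1 1)
    (Complex.I • (fieldR2 : Module.End ℂ SmoothFn) - (fieldR1 : Module.End ℂ SmoothFn)) := by
  intro F φ h p
  simp only [KL1, actsAs_pd _ F φ h p]
  simp [fieldR1, fieldR2, fieldCot, sinFn_apply, cosFn_apply, cscFn_apply, mul_comm Complex.I,
    Complex.exp_mul_I]
  -- The factor `i²` comes from `i sin α` in the exponential times the `i` before the `csc β` and
  -- `cot β` terms.
  linear_combination (Complex.sin (p.1 iα) * (Complex.sin (p.1 iβ))⁻¹ *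
    ((partialD iγ φ).1 p - Complex.cos (p.1 iβ) * (partialD iα φ).1 p)) * Complex.I_sq

lemma actsAs_KL1_neg_one : ActsAs (KL1 (-1))
    (Complex.I • (fieldR2 : Module.End ℂ SmoothFn) + (fieldR1 : Module.End ℂ SmoothFn)) := by
  intro F φ h p
  have he : Complex.exp (-1 * Complex.I * (p.1 iα : ℂ))
      = Complex.cos (p.1 iα) - Complex.sin (p.1 iα) * Complex.I := by
    rw [show -1 * Complex.I * (p.1 iα : ℂ) = -(p.1 iα : ℂ) * Complex.I by ring, Complex.exp_mul_I,
      Complex.cos_neg, Complex.sin_neg]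
    ring
  simp only [KL1, actsAs_pd _ F φ h p, he]
  simp [fieldR1, fieldR2, fieldCot, sinFn_apply, cosFn_apply, cscFn_apply]
  linear_combination (-Complex.sin (p.1 iα) * (Complex.sin (p.1 iβ))⁻¹ *
    ((partialD iγ φ).1 p - Complex.cos (p.1 iβ) * (partialD iα φ).1 p)) * Complex.I_sq

lemma actsAs_Z2 (ε : ℂ) : ActsAs (Z2 ε) ((2 : ℂ) • (fieldH2 : Module.End ℂ SmoothFn)
    - (fieldH1 : Module.End ℂ SmoothFn)
    + (ε * 2 * Complex.I) • (fieldN2 : Module.End ℂ SmoothFn)) := by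
  intro F φ h p
  simp only [Z2, actsAs_pd _ F φ h p]
  simp [fieldH1, fieldH2, fieldN2, coordFn_apply]
  ring

lemma actsAs_Z1 (ε : ℂ) : ActsAs (Z1 ε) ((-2 * Complex.I) • (fieldN1 : Module.End ℂ SmoothFn)
    - (ε * 2) • (fieldN3 : Module.End ℂ SmoothFn)) := by
  intro F φ h p
  simp only [Z1, actsAs_pd _ F φ h p]
  simp [fieldN1, fieldN3, coordFn_apply]
  ring

lemma actsAs_Z0 : ActsAs Z0 (-(Real.sqrt 6 : ℂ) • (fieldH1 : Module.End ℂ SmoothFn)) := by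
  intro F φ h p
  simp only [Z0, actsAs_pd _ F φ h p]
  simp [fieldH1, coordFn_apply]
  ring

/-- The first-order terms come from `y² ∂_y² = (y ∂_y)² - y ∂_y`. -/
lemma actsAs_sph1 {h1 h2 n1 n2 n3 : Module.End ℂ SmoothFn} (e1 : h1 = fieldH1) (e2 : h2 = fieldH2)
    (e3 : n1 = fieldN1) (e4 : n2 = fieldN2) (e5 : n3 = fieldN3) :
    ActsAs sph1 (-(h1 * h1) + h1 - h2 * h2 + h2 + h1 * h2 - n1 * n1 - n2 * n2 - n3 * n3) := by
  intro F φ h p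
  have hp := actsAs_pd
  have hpp := fun i j => ((hp i).comp (hp j)) F φ h p
  simp only [Function.comp_apply] at hpp
  simp only [sph1, hpp, ← coordFn_apply]
  subst e1 e2 e3 e4 e5
  have key : -(fieldH1 (fieldH1 φ)) + fieldH1 φ - fieldH2 (fieldH2 φ) + fieldH2 φ
      + fieldH1 (fieldH2 φ) - fieldN1 (fieldN1 φ) - fieldN2 (fieldN2 φ) - fieldN3 (fieldN3 φ)
      = -coordFn iy1 ^ 2 * partialD iy1 (partialD iy1 φ)
      - coordFn iy2 ^ 2 * partialD iy2 (partialD iy2 φ)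
      + coordFn iy1 * coordFn iy2 * partialD iy1 (partialD iy2 φ)
      - coordFn iy1 ^ 2 * (coordFn ix2 ^ 2 + coordFn iy2 ^ 2) * partialD ix3 (partialD ix3 φ)
      - coordFn iy1 ^ 2 * partialD ix1 (partialD ix1 φ)
      - coordFn iy2 ^ 2 * partialD ix2 (partialD ix2 φ)
      - 2 * coordFn iy1 ^ 2 * coordFn ix2 * partialD ix1 (partialD ix3 φ) := by
    simp only [fieldH1, fieldH2, fieldN1, fieldN2, fieldN3, ix1,
      ix2, ix3, iy1, iy2, Derivation.smul_apply, Derivation.add_apply,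
      smul_eq_mul, map_add, Derivation.leibniz, partialD_coordFn,
      partialD_comm, Fin.isValue, Fin.reduceEq, if_true, if_false]
    ring
  exact congrArg (fun ψ : SmoothFn => ψ.1 p) key.symm

/-- In the mixed term `n2` stands innermost, so that `∂_{x₂}` does not differentiate the coefficient
`x₂` of `n1`. -/
lemma actsAs_sph2 {h1 h2 n1 n2 n3 : Module.End ℂ SmoothFn} (e1 : h1 = fieldH1) (e2 : h2 = fieldH2)
    (e3 : n1 = fieldN1) (e4 : n2 = fieldN2) (e5 : n3 = fieldN3) :
    ActsAs sph2 (-(h1 * (h1 * h2)) + h1 * h2 + h1 * (h2 * h2) - h1 * h2 + n2 * (n2 * h1)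
      - n3 * (n3 * h1) + h1 * h1 - h1 - h2 * h2 + h2 - n2 * n2 - n1 * (n1 * h2) + n3 * (n3 * h2)
      + n1 * n1 + n3 * n3 + 2 • (n1 * (n3 * n2))) := by
  intro F φ h p
  have hp := actsAs_pd
  have hpp := fun i j => ((hp i).comp (hp j)) F φ h p
  have hppp := fun i j k => ((hp i).comp ((hp j).comp (hp k))) F φ h p
  simp only [Function.comp_apply] at hpp hppp
  simp only [sph2, hpp, hppp, ← coordFn_apply]
  subst e1 e2 e3 e4 e5
  have key : -(fieldH1 (fieldH1 (fieldH2 φ))) + fieldH1 (fieldH2 φ) + fieldH1 (fieldH2 (fieldH2 φ))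
      - fieldH1 (fieldH2 φ) + fieldN2 (fieldN2 (fieldH1 φ)) - fieldN3 (fieldN3 (fieldH1 φ))
      + fieldH1 (fieldH1 φ) - fieldH1 φ - fieldH2 (fieldH2 φ) + fieldH2 φ - fieldN2 (fieldN2 φ)
      - fieldN1 (fieldN1 (fieldH2 φ)) + fieldN3 (fieldN3 (fieldH2 φ)) + fieldN1 (fieldN1 φ)
      + fieldN3 (fieldN3 φ) + 2 • fieldN1 (fieldN3 (fieldN2 φ))
      = -coordFn iy1 ^ 2 * coordFn iy2 * partialD iy1 (partialD iy1 (partialD iy2 φ))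
      + coordFn iy1 * coordFn iy2 ^ 2 * partialD iy1 (partialD iy2 (partialD iy2 φ))
      - coordFn iy1 ^ 3 * coordFn iy2 ^ 2 * partialD ix3 (partialD ix3 (partialD iy1 φ))
      + coordFn iy1 * coordFn iy2 ^ 2 * partialD ix2 (partialD ix2 (partialD iy1 φ))
      - 2 * coordFn iy1 ^ 2 * coordFn iy2 * coordFn ix2
        * partialD ix1 (partialD ix3 (partialD iy2 φ))
      + (-coordFn ix2 ^ 2 + coordFn iy2 ^ 2) * coordFn iy1 ^ 2 * coordFn iy2
        * partialD ix3 (partialD ix3 (partialD iy2 φ))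
      - coordFn iy1 ^ 2 * coordFn iy2 * partialD ix1 (partialD ix1 (partialD iy2 φ))
      + 2 * coordFn iy1 ^ 2 * coordFn iy2 ^ 2 * partialD ix1 (partialD ix2 (partialD ix3 φ))
      + 2 * coordFn iy1 ^ 2 * coordFn iy2 ^ 2 * coordFn ix2
        * partialD ix2 (partialD ix3 (partialD ix3 φ))
      + coordFn iy1 ^ 2 * partialD iy1 (partialD iy1 φ)
      - coordFn iy2 ^ 2 * partialD iy2 (partialD iy2 φ)
      + 2 * coordFn iy1 ^ 2 * coordFn ix2 * partialD ix1 (partialD ix3 φ)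
      + (coordFn ix2 ^ 2 + coordFn iy2 ^ 2) * coordFn iy1 ^ 2 * partialD ix3 (partialD ix3 φ)
      + coordFn iy1 ^ 2 * partialD ix1 (partialD ix1 φ)
      - coordFn iy2 ^ 2 * partialD ix2 (partialD ix2 φ) := by
    simp only [fieldH1, fieldH2, fieldN1, fieldN2, fieldN3, ix1,
      ix2, ix3, iy1, iy2, Derivation.smul_apply, Derivation.add_apply, map_zero,
      smul_eq_mul, map_add, Derivation.leibniz, partialD_coordFn, Derivation.map_one_eq_zero,
      partialD_comm, Fin.isValue, Fin.reduceEq, if_true, if_false, nsmul_eq_mul, Nat.cast_ofNat]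
    ring
  exact congrArg (fun ψ : SmoothFn => ψ.1 p) key.symm

/-! ### Comparison of normal forms. -/

section Identities

variable {A : Type*} [Ring A] [Algebra ℂ A] {h1 h2 n1 n2 n3 r0 r1 r2 : A}

/-- The factor `-4` is `8 · (-1/2)`. Only the square of `s`, standing for `√2`, enters the
coefficients. -/
lemma quadratic_identity (h : IwasawaRelations h1 h2 n1 n2 n3 r0 r1 r2) {s : ℂ} (hs : s ^ 2 = 2) :
    (-4 : ℂ) • quadraticCasimir h1 h2 n1 n2 n3 r0 r1 r2
      = (8 : ℂ) • (-(h1 * h1) + h1 - h2 * h2 + h2 + h1 * h2 - n1 * n1 - n2 * n2 - n3 * n3)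
        - (2 : ℂ) • ((Complex.I • r2 - r1) * ((-2 * Complex.I) • n1 - ((-1 : ℂ) * 2) • n3))
        - (s * Complex.I) • ((-s • r0) * (((2 : ℂ) • h2 - h1 + ((1 : ℂ) * 2 * Complex.I) • n2)
            - ((2 : ℂ) • h2 - h1 + ((-1 : ℂ) * 2 * Complex.I) • n2)))
        - (2 : ℂ) • ((Complex.I • r2 + r1) * ((-2 * Complex.I) • n1 - ((1 : ℂ) * 2) • n3)) := by
  have hI := Complex.I_sq
  simp only [quadraticCasimir, smul_mul_assoc, mul_smul_comm, mul_add, add_mul, mul_sub, sub_mul,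
    h.r0_n2, h.r0_h1,
    h.r0_h2, h.r1_n1, h.r1_n3, h.r2_n1, h.r2_n3]
  match_scalars <;> grind

/-- The factors are `32 = 96/3` and `-48 = 96 · (-1/2)`, the latter from the summand `Δ₁` of `Δ₂`.
Sorting both sides into normal order leaves scalar identities that use only `s² = 2`, `t² = 6` and
`i² = -1`. -/
lemma cubic_identity (h : IwasawaRelations h1 h2 n1 n2 n3 r0 r1 r2) {s t : ℂ} (hs : s ^ 2 = 2)
    (ht : t ^ 2 = 6) {Z : ℂ → A} {W : ℂ → A}
    (hZ : ∀ ε, Z ε = (-2 * Complex.I) • n1 - (ε * 2) • n3)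
    (hW : ∀ ε, W ε = (2 : ℂ) • h2 - h1 + (ε * 2 * Complex.I) • n2) :
    (32 : ℂ) • cubicCasimir h1 h2 n1 n2 n3 r0 r1 r2
        + (-48 : ℂ) • quadraticCasimir h1 h2 n1 n2 n3 r0 r1 r2
      = (96 : ℂ) • (-(h1 * (h1 * h2)) + h1 * h2 + h1 * (h2 * h2) - h1 * h2 + n2 * (n2 * h1)
          - n3 * (n3 * h1) + h1 * h1 - h1 - h2 * h2 + h2 - n2 * n2 - n1 * (n1 * h2)
          + n3 * (n3 * h2) + n1 * n1 + n3 * n3 + 2 • (n1 * (n3 * n2)))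
        + (2 : ℂ) • ((Complex.I • r2 - r1)
          * (t • (Z (-1) * (-t • h1)) + (6 : ℂ) • ((1 - W (-1)) * Z 1)))
        + (s * Complex.I) • ((-s • r0) * ((3 : ℂ) • (Z 1 * Z 1 - Z (-1) * Z (-1))
          + (2 : ℂ) • ((t • (-t • h1) + (6 : ℂ) • 1) * (W (-1) - W 1))))
        + (2 : ℂ) • ((Complex.I • r2 + r1)
          * (t • (Z (- -1) * (-t • h1)) + (6 : ℂ) • ((1 - W (- -1)) * Z (-1))))
        + (6 * s * Complex.I) • ((Complex.I • r2 - r1 + (Complex.I • r2 + r1))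
          * ((-s • r0) * (Z (-1) - Z 1))) := by
  have hI := Complex.I_sq
  obtain ⟨c0, c1, c2, c3, c4, c5, c6, c7, c8, c9, c10, c11, c12, c13, c14, c15, c16, c17, c18, c19,
    c20, c21, c22, c23, c24, c25, c26, c27⟩ := h
  simp only [quadraticCasimir, cubicCasimir, hZ, hW, smul_mul_assoc, mul_smul_comm, mul_add,
    add_mul, mul_sub, sub_mul, mul_assoc,
    mul_one, one_mul, c0, mul_assoc_rule c0, c1, mul_assoc_rule c1, c2, mul_assoc_rule c2, c3,
    mul_assoc_rule c3, c4, mul_assoc_rule c4, c5, mul_assoc_rule c5, c6, mul_assoc_rule c6, c7,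
    mul_assoc_rule c7, c8, mul_assoc_rule c8, c9, mul_assoc_rule c9, c10, mul_assoc_rule c10, c11,
    mul_assoc_rule c11, c12, mul_assoc_rule c12, c13, mul_assoc_rule c13, c14, mul_assoc_rule c14,
    c15, mul_assoc_rule c15, c16, mul_assoc_rule c16, c17, mul_assoc_rule c17, c18,
    mul_assoc_rule c18, c19, mul_assoc_rule c19, c20, mul_assoc_rule c20, c21, mul_assoc_rule c21,
    c22, mul_assoc_rule c22, c23, mul_assoc_rule c23, c24, mul_assoc_rule c24, c25,
    mul_assoc_rule c25, c26, mul_assoc_rule c26, c27, mul_assoc_rule c27]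
  match_scalars <;> grind

end Identities

/-! ### The Casimir operators in coordinates. -/

lemma fieldOp_eq : fieldOp = borelMatrix (A := Module.End ℂ SmoothFn) fieldH1 fieldH2 fieldN1
    fieldN2 fieldN3
    fieldR0 fieldR1 fieldR2
      + diagonal ![0, 1, 2] := by
  rw [fieldOp]
  congr 1
  ext1 a b
  fin_cases a <;> fin_cases b <;> rfl

lemma sum_chartE_sq : ∑ i, ∑ j, chartE i j * chartE j i
    = quadraticCasimir (A := Module.End ℂ SmoothFn) fieldH1 fieldH2 fieldN1 fieldN2 fieldN3
    fieldR0 fieldR1 fieldR2 := by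
  have h := sum_conj_sq_eq (A := Module.End ℂ SmoothFn) (K := kOp) (P := fieldOp)
    iwasawaRelations_fields kOp_mul_transpose kOp_mul_fieldOp fieldOp_eq
  rw [← h]
  rfl

lemma sum_chartE_cube : ∑ i, ∑ j, ∑ k, chartE i j * (chartE j k * chartE k i)
    = cubicCasimir (A := Module.End ℂ SmoothFn) fieldH1 fieldH2 fieldN1 fieldN2 fieldN3
    fieldR0 fieldR1 fieldR2 := by
  have h := sum_conj_cube_eq (A := Module.End ℂ SmoothFn) (K := kOp) (P := fieldOp)
    iwasawaRelations_fields kOp_mul_transpose kOp_mul_fieldOp fieldOp_eq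
  rw [← h]
  rfl

lemma inCoords_casimir1 (f : G → ℂ) (hf : IsSmooth f) (p : chart) :
    inCoords (casimir1 f) p
      = (((-(1 / 2) : ℂ) • ∑ i, ∑ j, chartE i j * chartE j i) (chartFn f hf)).1 p := by
  have h : ∀ i j, (chartE i j (chartE j i (chartFn f hf))).1 p = inCoords (E i j (E j i f)) p :=
    fun i j => by rw [← chartFn_E, ← chartFn_E]; rfl
  have hd := det_iwasawa_ne_zero p.2
  simp only [LinearMap.smul_apply, LinearMap.sum_apply, Module.End.mul_apply]
  have h2 : ∀ Φ : Fin 3 → Fin 3 → SmoothFn, ((-(1 / 2) : ℂ) • ∑ i, ∑ j, Φ i j).1 p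
      = -(1 / 2) * ∑ i, ∑ j, (Φ i j).1 p := fun Φ => by simp
  rw [h2]
  simp only [h, inCoords, pullback, dif_pos hd]
  rfl

lemma inCoords_casimir2 (f : G → ℂ) (hf : IsSmooth f) (p : chart) :
    inCoords (casimir2 f) p
      = (((1 / 3 : ℂ) • ∑ i, ∑ j, ∑ k, chartE i j * (chartE j k * chartE k i)
        + (-(1 / 2) : ℂ) • ∑ i, ∑ j, chartE i j * chartE j i) (chartFn f hf)).1 p := by
  have h : ∀ i j k, (chartE i j (chartE j k (chartE k i (chartFn f hf)))).1 p
      = inCoords (E i j (E j k (E k i f))) p :=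
    fun i j k => by rw [← chartFn_E, ← chartFn_E, ← chartFn_E]; rfl
  have hd := det_iwasawa_ne_zero p.2
  have h1 := inCoords_casimir1 f hf p
  rw [LinearMap.add_apply]
  refine Eq.trans ?_ (congrArg₂ (· + ·) rfl h1)
  simp only [LinearMap.smul_apply, LinearMap.sum_apply, Module.End.mul_apply]
  have h2 : ∀ Φ : Fin 3 → Fin 3 → Fin 3 → SmoothFn, ((1 / 3 : ℂ) • ∑ i, ∑ j, ∑ k, Φ i j k).1 p
      = (1 / 3) * ∑ i, ∑ j, ∑ k, (Φ i j k).1 p := fun Φ => by simp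
  rw [h2]
  simp only [h, inCoords, pullback, dif_pos hd]
  rfl

end

end CasimirPGL3

open CasimirPGL3 in
theorem mainTheorem11 (f : G → ℂ) (hf : IsSmooth f) (p : Coords)
    (hy1 : 0 < p iy1) (hy2 : 0 < p iy2) (hβ : Real.sin (p iβ) ≠ 0) :
    (8 : ℂ) * inCoords (casimir1 f) p =
      ((8 : ℂ) • sph1
        - (2 : ℂ) • (KL1 1 ∘ Z1 (-1))
        - ((Real.sqrt 2 : ℂ) * Complex.I) • (KL0 ∘ (Z2 1 - Z2 (-1)))
        - (2 : ℂ) • (KL1 (-1) ∘ Z1 1)) (inCoords f) p ∧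
    (96 : ℂ) * inCoords (casimir2 f) p =
      ((96 : ℂ) • sph2
        + (2 : ℂ) • (KL1 1 ∘ T1 1)
        + ((Real.sqrt 2 : ℂ) * Complex.I) • (KL0 ∘ T0)
        + (2 : ℂ) • (KL1 (-1) ∘ T1 (-1))
        + (6 * (Real.sqrt 2 : ℂ) * Complex.I) •
            ((KL1 1 + KL1 (-1)) ∘ KL0 ∘ (Z1 (-1) - Z1 1))) (inCoords f) p := by
  have hs : (Real.sqrt 2 : ℂ) ^ 2 = 2 := by
    rw [← Complex.ofReal_pow, Real.sq_sqrt (by norm_num)]; norm_num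
  have ht : (Real.sqrt 6 : ℂ) ^ 2 = 6 := by
    rw [← Complex.ofReal_pow, Real.sq_sqrt (by norm_num)]; norm_num
  have hT1 := fun ε => (((actsAs_Z1 (-ε)).comp actsAs_Z0).smul (Real.sqrt 6 : ℂ)).add
    (((ActsAs.id.sub (actsAs_Z2 (-ε))).comp (actsAs_Z1 ε)).smul 6)
  have hT0 := ((((actsAs_Z1 1).comp (actsAs_Z1 1)).sub
      ((actsAs_Z1 (-1)).comp (actsAs_Z1 (-1)))).smul 3).add
    ((((actsAs_Z0.smul (Real.sqrt 6 : ℂ)).add (ActsAs.id.smul 6)).comp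
      ((actsAs_Z2 (-1)).sub (actsAs_Z2 1))).smul 2)
  have hR1 := ((((actsAs_sph1 rfl rfl rfl rfl rfl).smul 8).sub
    ((actsAs_KL1_one.comp (actsAs_Z1 (-1))).smul 2)).sub
    ((actsAs_KL0.comp ((actsAs_Z2 1).sub (actsAs_Z2 (-1)))).smul
      ((Real.sqrt 2 : ℂ) * Complex.I))).sub
    ((actsAs_KL1_neg_one.comp (actsAs_Z1 1)).smul 2)
  have hR2 := (((((actsAs_sph2 rfl rfl rfl rfl rfl).smul 96).add
    ((actsAs_KL1_one.comp (hT1 1)).smul 2)).add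
    ((actsAs_KL0.comp hT0).smul ((Real.sqrt 2 : ℂ) * Complex.I))).add
    ((actsAs_KL1_neg_one.comp (hT1 (-1))).smul 2)).add
    (((actsAs_KL1_one.add actsAs_KL1_neg_one).comp
      (actsAs_KL0.comp ((actsAs_Z1 (-1)).sub (actsAs_Z1 1)))).smul
        (6 * (Real.sqrt 2 : ℂ) * Complex.I))
  have hp : p ∈ chart := ⟨hy1, hy2, hβ⟩
  have q1 := quadratic_identity iwasawaRelations_fields hs
  have q2 := cubic_identity iwasawaRelations_fields hs ht (fun _ => rfl) (fun _ => rfl)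
  rw [← sum_chartE_sq] at q1
  rw [← sum_chartE_sq, ← sum_chartE_cube] at q2
  constructor
  -- Both sides are values at `p` of endomorphisms applied to the same function `chartFn f hf`, so
  -- the operator identity `q1` finishes up to scalars.
  · refine Eq.trans ?_ (hR1 (inCoords f) (chartFn f hf) (fun _ => rfl) ⟨p, hp⟩).symm
    rw [← q1, inCoords_casimir1 f hf ⟨p, hp⟩]
    simp only [LinearMap.smul_apply]
    generalize (∑ i, ∑ j, chartE i j * chartE j i) (chartFn f hf) = ψ
    change (8 : ℂ) * (-(1 / 2) * ψ.1 ⟨p, hp⟩) = -4 * ψ.1 ⟨p, hp⟩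
    ring
  · refine Eq.trans ?_ (hR2 (inCoords f) (chartFn f hf) (fun _ => rfl) ⟨p, hp⟩).symm
    rw [← q2, inCoords_casimir2 f hf ⟨p, hp⟩]
    simp only [LinearMap.smul_apply, LinearMap.add_apply]
    generalize (∑ i, ∑ j, chartE i j * chartE j i) (chartFn f hf) = ψ
    generalize (∑ i, ∑ j, ∑ k, chartE i j * (chartE j k * chartE k i)) (chartFn f hf) = χ
    change (96 : ℂ) * (1 / 3 * χ.1 ⟨p, hp⟩ + -(1 / 2) * ψ.1 ⟨p, hp⟩)
      = 32 * χ.1 ⟨p, hp⟩ + -48 * ψ.1 ⟨p, hp⟩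
    ring
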